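/- Let $\mathbb{D}$ be the open unit disc of $\mathbb{C}$ and, for $\nu\in\mathbb{R}$, let $\lambda_\nu(dz)=(1-|z|^2)^{2\nu-2}\,dz$ on $\mathbb{D}$, where $dz$ is Lebesgue measure. Let $\nu>1/2$ and let $m\in\{0,1,\dots,\lfloor\nu-1/2\rfloor\}$ with $2(\nu-m)-1\neq0$. Put $$G^\nu_m(z,w)=\frac{2(\nu-m)-1}{\pi}(1-z\bar w)^{-2\nu}\left(\frac{|1-z\bar w|^2}{(1-|z|^2)(1-|w|^2)}\right)^{m}P_m^{(0,2(\nu-m)-1)}\left(2\,\frac{(1-|z|^2)(1-|w|^2)}{|1-z\bar w|^2}-1\right),$$ where $P_m^{(\alpha,\beta)}$ is the Jacobi polynomial (this is the kernel associated with the hyperbolic Landau level $\epsilon^\nu_m=4m(2\nu-m-1)$). A point process on $\mathbb{D}$ is a probability measure on the space of subsets $X\subset\mathbb{D}$ having finitely many points in every compact subset of $\mathbb{D}$, with the $\sigma$-algebra generated by the maps $X\mapsto|X\cap A|$, $A$ a relatively compact Borel subset of $\mathbb{D}$. It is determinantal with kernel $K$ and reference measure $\mu$ if for every $n\in\mathbb{N}$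 and every bounded, compactly supported, measurable $f:\mathbb{D}^n\to\mathbb{C}$ the sum of $f(x_1,\dots,x_n)$ over all $n$-tuples of pairwise distinct points $x_1,\dots,x_n\in X$ is integrable, with $$\mathbb{E}\Big[\sum f(x_1,\dots,x_n)\Big]=\int_{\mathbb{D}^n}f(x_1,\dots,x_n)\det\big(K(x_i,x_j)\big)_{1\le i,j\le n}\,\mu(dx_1)\cdots\mu(dx_n).$$ Let $\mathbb{P}^\nu_m$ be the hyperbolic-type point process, that is, the determinantal point process on $\mathbb{D}$ with kernel $G^\nu_m$ and reference measure $\lambda_\nu$. For $0<r<1$ let $N_r$ be the number of its particles in $D_r=\{z:|z|<r\}$. Then $N_r$ is square integrable, and its variance $V^\nu_m(N_r)$ satisfies $$V^\nu_m(N_r)\sim\frac{C^\nu_m}{1-r^2},\qquad r\to1^-,$$ where the constant $C^\nu_m$ is given by the convergent integral $$C^\nu_m=\int_{\mathbb{D}}\lambda_0(dz)\,f_{\nu,m}(d(z,0))\arccos(1-2|z|^2).$$ Here $d(z,w)\ge0$ is the hyperbolic distance, defined by $\cosh^2(d(z,w))=\frac{|1-z\bar w|^2}{(1-|z|^2)(1-|w|^2)}$,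 and $$f_{\nu,m}(x)=\left[\frac{2(\nu-m)-1}{\pi}\,(1-\tanh^2x)^{\nu-m}\,P_m^{(0,2(\nu-m)-1)}(1-2\tanh^2x)\right]^2.$$ -/

import Mathlib

open MeasureTheory ProbabilityTheory Filter Topology Asymptotics
open scoped ComplexConjugate

noncomputable section

/-! ### Point processes and determinantal point processes -/

/-- Locally finite configurations: subsets having finitely many points in each compact set. -/
def Conf (E : Type*) [TopologicalSpace E] : Type _ :=
  {X : Set E // ∀ K : Set E, IsCompact K → (X ∩ K).Finite}

namespace Conf

variable {E : Type*} [TopologicalSpace E]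

/-- The number `N_A` of points of a configuration in `A` (a finite number when `A` is
relatively compact). -/
def count (A : Set E) (X : Conf E) : ℕ := (X.1 ∩ A).ncard

/-- The sigma-algebra generated by the maps `N_A`, `A` a relatively compact Borel set. -/
instance instMeasurableSpace [MeasurableSpace E] : MeasurableSpace (Conf E) :=
  ⨆ A : {A : Set E // MeasurableSet A ∧ IsCompact (closure A)},
    MeasurableSpace.comap (count A.1) ⊤

/-- The sum of `f (x₁, …, xₙ)` over all `n`-tuples of pairwise distinct points of `X`
(only finitely many terms are non-zero when `f` has compact support). -/
def tupleSum {n : ℕ} (f : (Fin n → E) → ℂ) (X : Conf E) : ℂ :=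
  ∑' x : Fin n ↪ X.1, f (fun i => (x i : E))

end Conf

/-- A point process `P` on `E` is determinantal with correlation kernel `K` and reference measure
`μ`: the `n`-point correlation functions with respect to `μ` are `det (K (x_i, x_j))`. -/
structure IsDeterminantal {E : Type*} [TopologicalSpace E] [MeasurableSpace E]
    (K : E → E → ℂ) (μ : Measure E) (P : Measure (Conf E)) : Prop where
  isProbabilityMeasure : IsProbabilityMeasure P
  integrable_tupleSum : ∀ (n : ℕ) (f : (Fin n → E) → ℂ), Measurable f → HasCompactSupport f →
    (∃ B : ℝ, ∀ x, ‖f x‖ ≤ B) → Integrable (Conf.tupleSum f) P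
  integral_tupleSum : ∀ (n : ℕ) (f : (Fin n → E) → ℂ), Measurable f → HasCompactSupport f →
    (∃ B : ℝ, ∀ x, ‖f x‖ ≤ B) →
    ∫ X, Conf.tupleSum f X ∂P =
      ∫ x : Fin n → E, f x * (Matrix.of fun i j => K (x i) (x j)).det ∂(Measure.pi fun _ => μ)

/-! ### The Poincaré disc and the hyperbolic-type kernel -/

/-- The open unit disc of `ℂ`. -/
abbrev Disk : Type := Metric.ball (0 : ℂ) 1

/-- The measure `(1 - |z|²) ^ (2ν - 2) dz` on the unit disc, `dz` being Lebesgue measure. -/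
def lam (ν : ℝ) : Measure Disk :=
  (Measure.comap ((↑) : Disk → ℂ) volume).withDensity
    fun z => ENNReal.ofReal ((1 - ‖(z : ℂ)‖ ^ 2) ^ (2 * ν - 2))

/-- The Jacobi polynomial `P_n^{(α,β)}` (for `α > -1`), through its hypergeometric expression
`(α+1)_n / n! * ₂F₁(-n, n+α+β+1; α+1; (1-x)/2)`. -/
def jacobiP (α β : ℝ) (n : ℕ) (x : ℝ) : ℝ :=
  (ascPochhammer ℝ n).eval (α + 1) / (n.factorial : ℝ) *
    ∑ k ∈ Finset.range (n + 1),
      (ascPochhammer ℝ k).eval (-(n : ℝ)) * (ascPochhammer ℝ k).eval ((n : ℝ) + α + β + 1) /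
        ((ascPochhammer ℝ k).eval (α + 1) * (k.factorial : ℝ)) * ((1 - x) / 2) ^ k

/-- The kernel `G_m^ν` attached to the hyperbolic Landau level `4m(2ν - m - 1)`. -/
def kernelG (ν : ℝ) (m : ℕ) (z w : Disk) : ℂ :=
  (((2 * (ν - m) - 1) / Real.pi : ℝ) : ℂ) *
    (1 - (z : ℂ) * conj (w : ℂ)) ^ (-2 * (ν : ℂ)) *
    (((‖1 - (z : ℂ) * conj (w : ℂ)‖ ^ 2 /
        ((1 - ‖(z : ℂ)‖ ^ 2) * (1 - ‖(w : ℂ)‖ ^ 2))) ^ m : ℝ) : ℂ) *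
    ((jacobiP 0 (2 * (ν - m) - 1) m
        (2 * ((1 - ‖(z : ℂ)‖ ^ 2) * (1 - ‖(w : ℂ)‖ ^ 2) /
          ‖1 - (z : ℂ) * conj (w : ℂ)‖ ^ 2) - 1) : ℝ) : ℂ)

/-- The hyperbolic distance, `cosh² d(z,w) = |1 - z w̄|² / ((1 - |z|²)(1 - |w|²))`. -/
def hypDist (z w : ℂ) : ℝ :=
  Real.arcosh (‖1 - z * conj w‖ / Real.sqrt ((1 - ‖z‖ ^ 2) * (1 - ‖w‖ ^ 2)))

/-- The function `f_{ν,m}`. -/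
def fFun (ν : ℝ) (m : ℕ) (x : ℝ) : ℝ :=
  ((2 * (ν - m) - 1) / Real.pi * (1 - Real.tanh x ^ 2) ^ (ν - m) *
    jacobiP 0 (2 * (ν - m) - 1) m (1 - 2 * Real.tanh x ^ 2)) ^ 2

/-- The integrand `f_{ν,m}(d(z,0)) arccos(1 - 2|z|²)` of the constant `C_m^ν`. -/
def constIntegrand (ν : ℝ) (m : ℕ) (z : Disk) : ℝ :=
  fFun ν m (hypDist (z : ℂ) 0) * Real.arccos (1 - 2 * ‖(z : ℂ)‖ ^ 2)

/-- The constant `C_m^ν`. -/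
def constC (ν : ℝ) (m : ℕ) : ℝ := ∫ z, constIntegrand ν m z ∂(lam 0)

/-- The disc `D_r` centered at the origin, of radius `r`, inside the unit disc. -/
def discD (r : ℝ) : Set Disk := {z | ‖(z : ℂ)‖ < r}

/-- The number `N_r` of particles in `D_r`, as a real random variable. -/
def numN (r : ℝ) (X : Conf Disk) : ℝ := (Conf.count (discD r) X : ℝ)

end

/-! Put `a = 2(ν - m) - 1 > 0`. The weights `(1 - |z|²)^(2ν)` turn both correlation terms into
Möbius-invariant objects for the hyperbolic area `lam 0`: the diagonal term has constant density `a
/ π`, and the squared modulus of the kernel becomes a function of the distance alone, `landauDensity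
ν m (invCoshSq z w)`, with `invCoshSq = 1 / cosh² d`.

The total mass of this function in `w` is again `a / π` (`lintegral_landauDensity_invCoshSq`). By
invariance it is enough to take `z = 0`, where it reduces to the norm of a Jacobi polynomial for the
weight `s^(a - 1)` (`integral_rpow_mul_jacobiP_sq`). In the determinantal formula `∫ K(z,z) - ∬
|K|²` over `D_r` the interior part then cancels, and the variance is the integral of the invariant
density over `D_r × D_rᶜ` (`variance_numN_eq`).

Substituting `w = moebius z u` and exchanging the integrals gives `∫ landauDensity(1 - |u|²) ·
exitArea r u` (`crossIntegral_eq`), where `exitArea r u` is the area of the points of `D_r` pushed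
out of `D_r` by the displacement `u`. This is a boundary effect: `(1 - r²) · exitArea r u` stays
below `2π` and tends to `arccos(1 - 2|u|²)` (`tendsto_ofReal_mul_exitArea`). Dominated convergence
gives the limit `constC ν m`, and its positivity turns the limit into an asymptotic equivalence. -/

noncomputable section

/-! ### Jacobi polynomials: coefficients and differential equation -/

open Polynomial in
/-- The polynomial `p` with `p (1 - s) = P_m^{(0,b)} (2 s - 1)`. -/
def jacobiPoly (b : ℝ) (m : ℕ) : ℝ[X] :=
  ∑ k ∈ Finset.range (m + 1), Polynomial.monomial k
    ((ascPochhammer ℝ k).eval (-(m : ℝ)) * (ascPochhammer ℝ k).eval ((m : ℝ) + b + 1) /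
      ((k.factorial : ℝ) * (k.factorial : ℝ)))

lemma jacobiP_eq_eval_jacobiPoly (b : ℝ) (m : ℕ) (s : ℝ) :
    jacobiP 0 b m (2 * s - 1) = (jacobiPoly b m).eval (1 - s) := by
  have h : (m.factorial : ℝ) ≠ 0 := by positivity
  simp only [jacobiP, zero_add, ascPochhammer_eval_one, div_self h, one_mul, jacobiPoly, add_zero,
    Polynomial.eval_finsetSum, Polynomial.eval_monomial]
  refine Finset.sum_congr rfl fun k _ => ?_
  congr 2; ring

lemma ascPochhammer_eval_neg_natCast_eq_zero {m k : ℕ} (h : m < k) :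
    (ascPochhammer ℝ k).eval (-(m : ℝ)) = 0 := by
  induction k, h using Nat.le_induction with
  | base => simp [ascPochhammer_succ_eval]
  | succ k _ ih => simp [ascPochhammer_succ_eval, ih]

lemma coeff_jacobiPoly (b : ℝ) (m k : ℕ) : (jacobiPoly b m).coeff k =
    (ascPochhammer ℝ k).eval (-(m : ℝ)) * (ascPochhammer ℝ k).eval ((m : ℝ) + b + 1) /
      ((k.factorial : ℝ) * (k.factorial : ℝ)) := by
  simp only [jacobiPoly, Polynomial.finsetSum_coeff, Polynomial.coeff_monomial]
  rw [Finset.sum_ite_eq']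
  split_ifs with h
  · rfl
  · rw [ascPochhammer_eval_neg_natCast_eq_zero (by simpa [Nat.lt_succ_iff] using h)]
    simp

/-- Since the Pochhammer factor vanishes beyond degree `m`, the hypergeometric recursion holds for
every `k`, with no cut-off at the degree. -/
lemma coeff_jacobiPoly_succ (b : ℝ) (m k : ℕ) :
    ((k : ℝ) + 1) ^ 2 * (jacobiPoly b m).coeff (k + 1) =
      ((k : ℝ) - m) * (k + m + b + 1) * (jacobiPoly b m).coeff k := by
  have h : (k.factorial : ℝ) ≠ 0 := by positivity
  have h' : (k : ℝ) + 1 ≠ 0 := by positivity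
  simp only [coeff_jacobiPoly, ascPochhammer_succ_eval, Nat.factorial_succ]
  push_cast
  field_simp
  ring

lemma natDegree_jacobiPoly_le (b : ℝ) (m : ℕ) : (jacobiPoly b m).natDegree ≤ m :=
  Polynomial.natDegree_le_iff_coeff_eq_zero.2 fun k hk => by
    rw [coeff_jacobiPoly, ascPochhammer_eval_neg_natCast_eq_zero hk]; simp

lemma eval_zero_jacobiPoly (b : ℝ) (m : ℕ) : (jacobiPoly b m).eval 0 = 1 := by
  rw [← Polynomial.coeff_zero_eq_eval_zero, coeff_jacobiPoly]; simp

open Polynomial in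
/-- The Jacobi differential equation. -/
lemma jacobiPoly_ode (b : ℝ) (m : ℕ) :
    X * (1 - X) * derivative (derivative (jacobiPoly b m)) +
      (1 - C (b + 2) * X) * derivative (jacobiPoly b m) =
      -C (m * (m + b + 1)) * jacobiPoly b m := by
  set p := jacobiPoly b m
  have h : ∀ k : ℕ, ((k : ℝ) + 1) ^ 2 * p.coeff (k + 1) =
      ((k : ℝ) - m) * (k + m + b + 1) * p.coeff k := coeff_jacobiPoly_succ b m
  have e : X * (1 - X) * derivative (derivative p) + (1 - C (b + 2) * X) * derivative p =
      X * derivative (derivative p) - X * (X * derivative (derivative p)) + derivative p -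
        C (b + 2) * (X * derivative p) := by ring
  rw [e]
  -- Each coefficient identity is the recursion at `k`. The degrees 0 and 1 are separate because the
  -- term with factor `X²` does not reach them.
  ext k
  rcases k with _ | _ | k
  · have := h 0
    simp [coeff_derivative, -map_add, -map_mul, neg_mul] at this ⊢
    linarith
  · have := h 1
    simp [coeff_derivative, -map_add, -map_mul, neg_mul] at this ⊢
    linarith
  · have := h (k + 2)
    simp [coeff_derivative, -map_add, -map_mul, neg_mul] at this ⊢
    linarith

/-! ### Orthogonality and the Jacobi norm -/

lemma intervalIntegrable_rpow_mul_eval {b : ℝ} (hb : -1 < b) (q : Polynomial ℝ) :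
    IntervalIntegrable (fun s : ℝ => s ^ b * q.eval (1 - s)) volume 0 1 :=
  (intervalIntegral.intervalIntegrable_rpow' hb).mul_continuousOn (by fun_prop)

/-- The integral of `s ^ b * q (1 - s)` over `[0, 1]`, as a linear functional of `q`. -/
def jacobiFunctional (b : ℝ) (q : Polynomial ℝ) : ℝ := ∫ s in (0 : ℝ)..1, s ^ b * q.eval (1 - s)

lemma jacobiFunctional_add {b : ℝ} (hb : -1 < b) (p q : Polynomial ℝ) :
    jacobiFunctional b (p + q) = jacobiFunctional b p + jacobiFunctional b q := by
  simp only [jacobiFunctional, Polynomial.eval_add, mul_add]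
  exact intervalIntegral.integral_add (intervalIntegrable_rpow_mul_eval hb p)
    (intervalIntegrable_rpow_mul_eval hb q)

lemma jacobiFunctional_C_mul (b c : ℝ) (p : Polynomial ℝ) :
    jacobiFunctional b (Polynomial.C c * p) = c * jacobiFunctional b p := by
  simp only [jacobiFunctional, Polynomial.eval_mul, Polynomial.eval_C]
  rw [← intervalIntegral.integral_const_mul]
  congr 1; ext s; ring

lemma jacobiFunctional_sum {b : ℝ} (hb : -1 < b) {ι : Type*} (s : Finset ι)
    (p : ι → Polynomial ℝ) :
    jacobiFunctional b (∑ i ∈ s, p i) = ∑ i ∈ s, jacobiFunctional b (p i) := by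
  classical
  induction s using Finset.induction_on with
  | empty => simp [jacobiFunctional]
  | insert i s hi ih => rw [Finset.sum_insert hi, Finset.sum_insert hi, jacobiFunctional_add hb, ih]

lemma hasDerivAt_eval_one_sub (q : Polynomial ℝ) (s : ℝ) :
    HasDerivAt (fun s : ℝ => q.eval (1 - s)) (-(Polynomial.derivative q).eval (1 - s)) s := by
  have h := (q.hasDerivAt (1 - s)).comp s ((hasDerivAt_id s).const_sub 1)
  simpa [Function.comp_def] using h

lemma hasDerivAt_rpow_mul_eval {b s : ℝ} (hs : 0 < s) (q : Polynomial ℝ) :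
    HasDerivAt (fun s : ℝ => s ^ b * q.eval (1 - s))
      (b * (s ^ (b - 1) * q.eval (1 - s)) -
        s ^ b * (Polynomial.derivative q).eval (1 - s)) s := by
  refine ((Real.hasDerivAt_rpow_const (p := b) (Or.inl hs.ne')).fun_mul
    (hasDerivAt_eval_one_sub q s)).congr_deriv ?_
  ring

/-- The boundary term at `s = 0` vanishes because `b > 0`; the one at `s = 1` is `q(0)`. -/
lemma integral_rpow_by_parts {b : ℝ} (hb : 0 < b) (q : Polynomial ℝ) :
    b * jacobiFunctional (b - 1) q - jacobiFunctional b (Polynomial.derivative q) = q.eval 0 := by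
  have i1 := intervalIntegrable_rpow_mul_eval (b := b - 1) (by linarith) q
  have i2 := intervalIntegrable_rpow_mul_eval (b := b) (by linarith) (Polynomial.derivative q)
  have := intervalIntegral.integral_eq_sub_of_hasDerivAt_of_le
    (f := fun s : ℝ => s ^ b * q.eval (1 - s)) zero_le_one
    ((Real.continuous_rpow_const hb.le).mul (by fun_prop)).continuousOn
    (fun s hs => hasDerivAt_rpow_mul_eval hs.1 q) ((i1.const_mul b).sub i2)
  rw [intervalIntegral.integral_sub (i1.const_mul b) i2,
    intervalIntegral.integral_const_mul] at this
  simpa [jacobiFunctional, Real.zero_rpow hb.ne'] using this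

-- Green's formula for the Jacobi operator, self-adjoint for the weight `s^b` with `s = 1 - X`: on
-- `X^j` it produces only `X^j` and `X^(j-1)`, and on `jacobiPoly b m` it acts as a scalar.
open Polynomial in
lemma jacobiFunctional_moment_recursion {b : ℝ} (hb : 0 < b) (m j : ℕ) :
    (j * (b + 1 + j) - m * (m + b + 1)) * jacobiFunctional b (X ^ j * jacobiPoly b m) =
      (j : ℝ) ^ 2 * jacobiFunctional b (X ^ (j - 1) * jacobiPoly b m) := by
  set p := jacobiPoly b m with hp
  have hode := jacobiPoly_ode b m
  rw [← hp] at hode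
  -- Up to sign and the weight `s^(b+1)`, `Q` is the boundary term in Green's formula for the pair
  -- `X^j`, `p`; it vanishes at 0.
  set Q : ℝ[X] := X ^ j * (C (j : ℝ) * p - X * derivative p) with hQ
  have hQ0 : Q.eval 0 = 0 := by
    rcases j with _ | j <;> simp [hQ]
  have h := integral_rpow_by_parts (b := b + 1) (by linarith) Q
  have e1 : jacobiFunctional b Q = jacobiFunctional (b + 1 - 1) Q := by rw [add_sub_cancel_right]
  have e2 : jacobiFunctional (b + 1) (derivative Q) =
      jacobiFunctional b ((1 - X) * derivative Q) := by
    simp only [jacobiFunctional]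
    refine intervalIntegral.integral_congr fun s hs => ?_
    rw [Set.uIcc_of_le zero_le_one] at hs
    simp only [eval_mul, eval_sub, eval_one, eval_X]
    rw [Real.rpow_add_one' hs.1 (by linarith)]
    ring
  rw [← e1, e2, hQ0, ← jacobiFunctional_C_mul] at h
  have e3 : C (b + 1) * Q + C (-1) * ((1 - X) * derivative Q) +
      C ((j : ℝ) ^ 2) * (X ^ (j - 1) * p) =
      C (j * (b + 1 + j) - m * (m + b + 1)) * (X ^ j * p) := by
    -- At `j = 0` the truncated exponent `j - 1` is harmless, since the factor `j` vanishes.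
    have hX : C (j : ℝ) * (X ^ (j - 1) * X) = C (j : ℝ) * X ^ j := by
      rcases j with _ | j
      · simp
      · rw [Nat.add_sub_cancel, pow_succ]
    simp only [hQ, derivative_mul, derivative_X_pow, derivative_sub, derivative_C, derivative_X]
    simp only [map_mul, map_add, map_sub, map_neg, map_one, map_pow, map_natCast] at hX hode ⊢
    have hX2 := congrArg (· * derivative p) hX
    simp only [map_ofNat] at *
    linear_combination X ^ j * hode + (j : ℝ[X]) * p * hX + (1 - X) * hX2
  have h1 : (-1 : ℝ) < b := by linarith
  rw [← jacobiFunctional_C_mul, ← jacobiFunctional_C_mul, ← e3, jacobiFunctional_add h1,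
    jacobiFunctional_add h1, jacobiFunctional_C_mul b (-1)]
  linarith

-- Induction on `j`: the scalar on the left of the moment recursion is nonzero for `j < m`, and the
-- right side is zero at `j = 0`.
open Polynomial in
lemma jacobiFunctional_moment_eq_zero {b : ℝ} (hb : 0 < b) {m j : ℕ} (hj : j < m) :
    jacobiFunctional b (X ^ j * jacobiPoly b m) = 0 := by
  have hne : ∀ i : ℕ, i < m → (i * (b + 1 + i) - m * (m + b + 1) : ℝ) ≠ 0 := fun i hi => by
    have : (i : ℝ) < m := by exact_mod_cast hi
    have h0 : (0 : ℝ) ≤ i := by positivity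
    nlinarith
  induction j with
  | zero =>
    have := jacobiFunctional_moment_recursion hb m 0
    simpa [hj.ne', (show (m : ℝ) + b + 1 ≠ 0 by positivity)] using this
  | succ j ih =>
    have := jacobiFunctional_moment_recursion hb m (j + 1)
    rw [Nat.add_sub_cancel, ih (by omega), mul_zero] at this
    exact (mul_eq_zero.1 this).resolve_left (hne _ hj)

lemma jacobiFunctional_mul_jacobiPoly_eq_zero {b : ℝ} (hb : 0 < b) {m : ℕ} {q : Polynomial ℝ}
    (hq : q.natDegree < m) : jacobiFunctional b (q * jacobiPoly b m) = 0 := by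
  rw [q.as_sum_range' m hq, Finset.sum_mul, jacobiFunctional_sum (by linarith)]
  refine Finset.sum_eq_zero fun j hj => ?_
  rw [← Polynomial.C_mul_X_pow_eq_monomial, mul_assoc, jacobiFunctional_C_mul,
    jacobiFunctional_moment_eq_zero hb (Finset.mem_range.1 hj), mul_zero]

/-- The weight is `s^(b-1)`, not the orthogonality weight `s^b`. Integrating `p²` by parts relates
the two: the derivative term `2 p p'` vanishes by orthogonality since `deg p' < m`, leaving `p(0)² =
1`. -/
lemma integral_rpow_mul_jacobiP_sq {b : ℝ} (hb : 0 < b) (m : ℕ) :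
    ∫ s in (0 : ℝ)..1, s ^ (b - 1) * jacobiP 0 b m (2 * s - 1) ^ 2 = 1 / b := by
  have h := integral_rpow_by_parts hb (jacobiPoly b m ^ 2)
  have h0 : jacobiFunctional b (Polynomial.derivative (jacobiPoly b m ^ 2)) = 0 := by
    rcases Nat.eq_zero_or_pos m with rfl | hm
    · have : jacobiPoly b 0 = Polynomial.C 1 := by simp [jacobiPoly]
      simp [this, jacobiFunctional]
    · rw [Polynomial.derivative_sq, mul_assoc, jacobiFunctional_C_mul,
        mul_comm (jacobiPoly b m), jacobiFunctional_mul_jacobiPoly_eq_zero hb, mul_zero]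
      have h1 := Polynomial.natDegree_derivative_le (jacobiPoly b m)
      have h2 := natDegree_jacobiPoly_le b m
      omega
  rw [h0, sub_zero, Polynomial.eval_pow, eval_zero_jacobiPoly, one_pow] at h
  rw [eq_div_iff hb.ne', mul_comm]
  refine Eq.trans ?_ h
  simp only [jacobiFunctional, jacobiP_eq_eval_jacobiPoly, Polynomial.eval_pow]

lemma continuous_jacobiP (α β : ℝ) (n : ℕ) : Continuous (jacobiP α β n) := by
  unfold jacobiP; fun_prop

lemma jacobiP_zero_one (b : ℝ) (m : ℕ) : jacobiP 0 b m 1 = 1 := by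
  have := jacobiP_eq_eval_jacobiPoly b m 1
  rwa [sub_self, eval_zero_jacobiPoly, mul_one, show (2 : ℝ) - 1 = 1 by norm_num] at this

lemma lintegral_rpow_mul_jacobiP_sq {b : ℝ} (hb : 0 < b) (m : ℕ) :
    ∫⁻ s in Set.Ioo (0 : ℝ) 1, ENNReal.ofReal (s ^ (b - 1) * jacobiP 0 b m (2 * s - 1) ^ 2) =
      ENNReal.ofReal (1 / b) := by
  have hi : IntervalIntegrable (fun s : ℝ => s ^ (b - 1) * jacobiP 0 b m (2 * s - 1) ^ 2)
      volume 0 1 :=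
    (intervalIntegral.intervalIntegrable_rpow' (by linarith)).mul_continuousOn
      (((continuous_jacobiP 0 b m).comp (by fun_prop)).pow 2).continuousOn
  rw [intervalIntegrable_iff_integrableOn_Ioo_of_le zero_le_one] at hi
  rw [← ofReal_integral_eq_lintegral_ofReal hi, ← integral_Ioc_eq_integral_Ioo,
    ← intervalIntegral.integral_of_le zero_le_one, integral_rpow_mul_jacobiP_sq hb]
  refine (ae_restrict_mem measurableSet_Ioo).mono fun s hs => ?_
  have := hs.1
  positivity

/-! ### Integration against `lam ν` -/

lemma lintegral_lam (ν : ℝ) {g : ℂ → ENNReal} (hg : Measurable g) :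
    ∫⁻ z : Disk, g z ∂(lam ν) =
      ∫⁻ z in Metric.ball (0 : ℂ) 1, ENNReal.ofReal ((1 - ‖z‖ ^ 2) ^ (2 * ν - 2)) * g z := by
  rw [lam, lintegral_withDensity_eq_lintegral_mul₀ (by fun_prop) (by fun_prop)]
  exact lintegral_subtype_comap (μ := (volume : Measure ℂ)) Metric.isOpen_ball.measurableSet
    (fun z => ENNReal.ofReal ((1 - ‖z‖ ^ 2) ^ (2 * ν - 2)) * g z)

lemma one_sub_norm_sq_pos {z : ℂ} (hz : z ∈ Metric.ball (0 : ℂ) 1) : 0 < 1 - ‖z‖ ^ 2 := by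
  rw [mem_ball_zero_iff] at hz
  nlinarith [norm_nonneg z]

/-! ### Polar coordinates -/

/-- The substitution `x = √(1 - s)` makes `s = 1 - |z|²` the radial coordinate, in which Lebesgue
measure has constant density `1/2`. -/
lemma lintegral_Ioo_comp_sqrt_one_sub (g : ℝ → ENNReal) :
    ∫⁻ x in Set.Ioo (0 : ℝ) 1, ENNReal.ofReal x * g x =
      ∫⁻ s in Set.Ioo (0 : ℝ) 1, ENNReal.ofReal (1 / 2) * g (Real.sqrt (1 - s)) := by
  have himg : (fun s : ℝ => Real.sqrt (1 - s)) '' Set.Ioo 0 1 = Set.Ioo 0 1 := by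
    ext x
    constructor
    · rintro ⟨s, ⟨h0, h1⟩, rfl⟩
      exact ⟨Real.sqrt_pos.2 (by linarith), by rw [Real.sqrt_lt' one_pos]; linarith⟩
    · rintro ⟨h0, h1⟩
      refine ⟨1 - x ^ 2, ⟨by nlinarith, by nlinarith⟩, ?_⟩
      simp [Real.sqrt_sq h0.le]
  have hder : ∀ s ∈ Set.Ioo (0 : ℝ) 1, HasDerivWithinAt (fun s : ℝ => Real.sqrt (1 - s))
      (-1 / (2 * Real.sqrt (1 - s))) (Set.Ioo 0 1) s := fun s hs =>
    (((hasDerivAt_id s).const_sub 1).sqrt (by simpa using (sub_pos.2 hs.2).ne')).hasDerivWithinAt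
  have hinj : Set.InjOn (fun s : ℝ => Real.sqrt (1 - s)) (Set.Ioo 0 1) := fun s hs t ht h => by
    have := (Real.sqrt_inj (by linarith [hs.2]) (by linarith [ht.2])).1 h
    linarith
  have := lintegral_image_eq_lintegral_abs_deriv_mul measurableSet_Ioo hder hinj
    (fun x => ENNReal.ofReal x * g x)
  rw [himg] at this
  rw [this]
  refine setLIntegral_congr_fun measurableSet_Ioo fun s hs => ?_
  have h : 0 < Real.sqrt (1 - s) := Real.sqrt_pos.2 (by linarith [hs.2])
  rw [← mul_assoc, ← ENNReal.ofReal_mul (by positivity), abs_div, abs_neg, abs_one,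
    abs_of_pos (by positivity)]
  congr 2; field_simp

/-- The point of the unit disc with polar angle `θ` and squared modulus `1 - s`. -/
def polarPt (θ s : ℝ) : ℂ := (Real.sqrt (1 - s) : ℂ) * (Real.cos θ + Real.sin θ * Complex.I)

lemma norm_cos_add_sin_I (θ : ℝ) : ‖(Real.cos θ + Real.sin θ * Complex.I : ℂ)‖ = 1 := by
  rw [Complex.ofReal_cos, Complex.ofReal_sin, ← Complex.exp_mul_I]
  exact Complex.norm_exp_ofReal_mul_I θ

lemma norm_polarPt (θ s : ℝ) : ‖polarPt θ s‖ = Real.sqrt (1 - s) := by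
  rw [polarPt, norm_mul, norm_cos_add_sin_I, mul_one, Complex.norm_real, Real.norm_eq_abs,
    abs_of_nonneg (Real.sqrt_nonneg _)]

lemma one_sub_norm_polarPt_sq (θ : ℝ) {s : ℝ} (hs : s ≤ 1) : 1 - ‖polarPt θ s‖ ^ 2 = s := by
  rw [norm_polarPt, Real.sq_sqrt (by linarith)]; ring

lemma lintegral_ball_eq_polar {h : ℂ → ENNReal} (hh : Measurable h) :
    ∫⁻ z in Metric.ball (0 : ℂ) 1, h z =
      ∫⁻ θ in Set.Ioo (-Real.pi) Real.pi, ∫⁻ s in Set.Ioo (0 : ℝ) 1,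
        ENNReal.ofReal (1 / 2) * h (polarPt θ s) := by
  have hm : Measurable ((Metric.ball (0 : ℂ) 1).indicator h) :=
    hh.indicator Metric.isOpen_ball.measurableSet
  have hsymm : Measurable fun p : ℝ × ℝ => Complex.polarCoord.symm p := by
    simp only [Complex.polarCoord_symm_apply]; fun_prop
  rw [← lintegral_indicator Metric.isOpen_ball.measurableSet,
    ← Complex.lintegral_comp_polarCoord_symm, polarCoord_target, Measure.volume_eq_prod,
    setLIntegral_prod_symm _ (by
      simp only [smul_eq_mul]
      exact ((ENNReal.measurable_ofReal.comp measurable_fst).mul (hm.comp hsymm)).aemeasurable)]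
  refine lintegral_congr fun θ => ?_
  simp only [polarPt]
  rw [← lintegral_Ioo_comp_sqrt_one_sub
    (fun x => h ((x : ℂ) * (Real.cos θ + Real.sin θ * Complex.I))),
    ← lintegral_indicator measurableSet_Ioi, ← lintegral_indicator measurableSet_Ioo]
  refine lintegral_congr fun x => ?_
  have hn : 0 < x → ‖(x : ℂ) * (Real.cos θ + Real.sin θ * Complex.I)‖ = x := fun hx => by
    rw [norm_mul, norm_cos_add_sin_I, mul_one, Complex.norm_real, Real.norm_eq_abs, abs_of_pos hx]
  have hb : 0 < x → (Complex.polarCoord.symm (x, θ) ∈ Metric.ball (0 : ℂ) 1 ↔ x < 1) :=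
    fun hx => by rw [Complex.polarCoord_symm_apply, mem_ball_zero_iff, hn hx]
  simp only [Set.indicator, Set.mem_Ioi, Set.mem_Ioo, smul_eq_mul]
  by_cases hx : 0 < x
  · by_cases hx1 : x < 1
    · rw [if_pos hx, if_pos ((hb hx).2 hx1), if_pos ⟨hx, hx1⟩, Complex.polarCoord_symm_apply]
    · rw [if_pos hx, if_neg (mt (hb hx).1 hx1), if_neg (fun h => hx1 h.2), mul_zero]
  · simp [hx]

/-! ### Möbius transformations -/

/-- The disc automorphism `u ↦ (u + z) / (1 + z̄ u)`. -/
def moebius (z u : ℂ) : ℂ := (u + z) / (1 + conj z * u)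

lemma one_add_conj_mul_ne_zero {z u : ℂ} (hz : ‖z‖ < 1) (hu : ‖u‖ < 1) :
    1 + conj z * u ≠ 0 := fun h => by
  have h1 : ‖conj z * u‖ < 1 := by
    rw [norm_mul, Complex.norm_conj]; nlinarith [norm_nonneg z, norm_nonneg u]
  rw [add_comm, add_eq_zero_iff_eq_neg] at h
  rw [h, norm_neg, norm_one] at h1
  exact lt_irrefl _ h1

lemma norm_one_add_sq_sub (z u : ℂ) :
    ‖1 + conj z * u‖ ^ 2 - ‖u + z‖ ^ 2 = (1 - ‖z‖ ^ 2) * (1 - ‖u‖ ^ 2) := by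
  simp only [← Complex.normSq_eq_norm_sq, Complex.normSq_apply, Complex.add_re, Complex.add_im,
    Complex.mul_re, Complex.mul_im, Complex.conj_re, Complex.conj_im, Complex.one_re,
    Complex.one_im]
  ring

lemma one_sub_norm_moebius_sq {z u : ℂ} (hz : ‖z‖ < 1) (hu : ‖u‖ < 1) :
    1 - ‖moebius z u‖ ^ 2 = (1 - ‖z‖ ^ 2) * (1 - ‖u‖ ^ 2) / ‖1 + conj z * u‖ ^ 2 := by
  have h : ‖1 + conj z * u‖ ^ 2 ≠ 0 := by simpa using one_add_conj_mul_ne_zero hz hu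
  rw [← norm_one_add_sq_sub, moebius, norm_div, div_pow, sub_div, div_self h]

lemma norm_moebius_lt_one {z u : ℂ} (hz : ‖z‖ < 1) (hu : ‖u‖ < 1) : ‖moebius z u‖ < 1 := by
  have h := one_sub_norm_moebius_sq hz hu
  have h0 : 0 < ‖1 + conj z * u‖ := norm_pos_iff.2 (one_add_conj_mul_ne_zero hz hu)
  have h1 := one_sub_norm_sq_pos (mem_ball_zero_iff.2 hz)
  have h2 := one_sub_norm_sq_pos (mem_ball_zero_iff.2 hu)
  have : 0 < 1 - ‖moebius z u‖ ^ 2 := by rw [h]; positivity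
  nlinarith [norm_nonneg (moebius z u)]

lemma moebius_neg_moebius {z u : ℂ} (hz : ‖z‖ < 1) (hu : ‖u‖ < 1) :
    moebius (-z) (moebius z u) = u := by
  have h := one_add_conj_mul_ne_zero hz hu
  have h1 : (1 - conj z * z : ℂ) ≠ 0 := by
    rw [Complex.conj_mul', ← Complex.ofReal_pow, ← Complex.ofReal_one, ← Complex.ofReal_sub]
    exact_mod_cast (one_sub_norm_sq_pos (mem_ball_zero_iff.2 hz)).ne'
  have h2 : 1 + conj (-z) * ((u + z) / (1 + conj z * u)) =
      (1 - conj z * z) / (1 + conj z * u) := by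
    rw [map_neg]; field_simp; ring
  rw [moebius, moebius, h2, div_eq_iff (div_ne_zero h1 h), div_add' _ _ _ h, mul_div_assoc']
  congr 1; ring

lemma hasDerivAt_moebius {z u : ℂ} (hz : ‖z‖ < 1) (hu : ‖u‖ < 1) :
    HasDerivAt (moebius z) ((1 - conj z * z) / (1 + conj z * u) ^ 2) u := by
  have h := one_add_conj_mul_ne_zero hz hu
  refine (((hasDerivAt_id u).add_const z).div
    (((hasDerivAt_id u).const_mul (conj z)).const_add 1) h).congr_deriv ?_
  simp only [id]
  congr 1; ring

lemma det_smul_one_complex (c : ℂ) : (c • (1 : ℂ →L[ℝ] ℂ)).det = ‖c‖ ^ 2 := by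
  have := LinearMap.det_restrictScalars (R := ℝ) (S := ℂ) (f := c • (LinearMap.id : ℂ →ₗ[ℂ] ℂ))
  rw [LinearMap.det_smul, LinearMap.det_id, Algebra.norm_complex_apply,
    Complex.normSq_eq_norm_sq] at this
  rw [mul_one, Module.finrank_self, pow_one] at this
  exact this

lemma image_moebius_ball {z : ℂ} (hz : ‖z‖ < 1) :
    moebius z '' Metric.ball 0 1 = Metric.ball 0 1 := by
  ext w
  simp only [Set.mem_image, mem_ball_zero_iff]
  constructor
  · rintro ⟨u, hu, rfl⟩
    exact norm_moebius_lt_one hz hu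
  · intro hw
    have hz' : ‖-z‖ < 1 := by rwa [norm_neg]
    refine ⟨moebius (-z) w, norm_moebius_lt_one hz' hw, ?_⟩
    simpa using moebius_neg_moebius hz' hw

lemma measurable_moebius (z : ℂ) : Measurable (moebius z) := by
  unfold moebius; fun_prop

/-- Invariance of hyperbolic area: the real Jacobian `|φ'(u)|²` equals `((1 - |φ(u)|²) / (1 -
|u|²))²`, which exactly compensates the density `(1 - |·|²)^(-2)`. -/
lemma lintegral_comp_moebius {z : ℂ} (hz : ‖z‖ < 1) {g : ℂ → ENNReal} (hg : Measurable g) :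
    ∫⁻ u : Disk, g (moebius z u) ∂(lam 0) = ∫⁻ w : Disk, g w ∂(lam 0) := by
  have hinj : Set.InjOn (moebius z) (Metric.ball 0 1) := fun u hu v hv h => by
    rw [mem_ball_zero_iff] at hu hv
    rw [← moebius_neg_moebius hz hu, h, moebius_neg_moebius hz hv]
  have hder : ∀ u ∈ Metric.ball (0 : ℂ) 1, HasFDerivWithinAt (moebius z)
      (((1 - conj z * z) / (1 + conj z * u) ^ 2) • (1 : ℂ →L[ℝ] ℂ)) (Metric.ball 0 1) u :=
    fun u hu =>
      (hasDerivAt_moebius hz (mem_ball_zero_iff.1 hu)).complexToReal_fderiv.hasFDerivWithinAt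
  rw [lintegral_lam 0 hg,
    lintegral_lam 0 (g := fun u => g (moebius z u)) (hg.comp (measurable_moebius z))]
  conv_rhs => rw [← image_moebius_ball hz]
  rw [lintegral_image_eq_lintegral_abs_det_fderiv_mul volume Metric.isOpen_ball.measurableSet
    hder hinj]
  refine setLIntegral_congr_fun Metric.isOpen_ball.measurableSet fun u hu => ?_
  have h1 := one_sub_norm_sq_pos hu
  have h2 := one_sub_norm_sq_pos (mem_ball_zero_iff.2 hz)
  rw [mem_ball_zero_iff] at hu
  have h3 : 0 < ‖1 + conj z * u‖ := norm_pos_iff.2 (one_add_conj_mul_ne_zero hz hu)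
  have h4 : ‖(1 - conj z * z : ℂ)‖ = 1 - ‖z‖ ^ 2 := by
    rw [Complex.conj_mul', ← Complex.ofReal_pow, ← Complex.ofReal_one, ← Complex.ofReal_sub,
      Complex.norm_real, Real.norm_eq_abs, abs_of_pos h2]
  rw [det_smul_one_complex, norm_div, norm_pow, h4, one_sub_norm_moebius_sq hz hu, ← mul_assoc,
    abs_of_nonneg (by positivity), ← ENNReal.ofReal_mul (by positivity)]
  congr 2
  rw [show (2 * 0 - 2 : ℝ) = -(2 : ℕ) by norm_num, Real.rpow_neg (by positivity),
    Real.rpow_neg (by positivity), Real.rpow_natCast, Real.rpow_natCast]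
  field_simp

lemma lintegral_lam_zero_radial {g : ℝ → ENNReal} (hg : Measurable g) :
    ∫⁻ z : Disk, g (1 - ‖(z : ℂ)‖ ^ 2) ∂(lam 0) =
      ENNReal.ofReal Real.pi *
        ∫⁻ s in Set.Ioo (0 : ℝ) 1, ENNReal.ofReal (s ^ (-2 : ℝ)) * g s := by
  rw [lintegral_lam 0 (g := fun z => g (1 - ‖z‖ ^ 2)) (by fun_prop),
    lintegral_ball_eq_polar (by fun_prop)]
  have : ∀ θ : ℝ, ∫⁻ s in Set.Ioo (0 : ℝ) 1, ENNReal.ofReal (1 / 2) *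
      (ENNReal.ofReal ((1 - ‖polarPt θ s‖ ^ 2) ^ (2 * 0 - 2 : ℝ)) * g (1 - ‖polarPt θ s‖ ^ 2)) =
      ENNReal.ofReal (1 / 2) *
        ∫⁻ s in Set.Ioo (0 : ℝ) 1, ENNReal.ofReal (s ^ (-2 : ℝ)) * g s := fun θ => by
    rw [← lintegral_const_mul _ (by fun_prop)]
    refine setLIntegral_congr_fun measurableSet_Ioo fun s hs => ?_
    simp only [one_sub_norm_polarPt_sq θ hs.2.le]
    norm_num
  simp only [this]
  rw [setLIntegral_const, Real.volume_Ioo, mul_comm, ← mul_assoc,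
    ← ENNReal.ofReal_mul (by linarith [Real.pi_pos])]
  congr 2; ring

lemma lintegral_lam_zero_rotation (c : Circle) {g : ℂ → ENNReal} (hg : Measurable g) :
    ∫⁻ z : Disk, g (c * z) ∂(lam 0) = ∫⁻ z : Disk, g z ∂(lam 0) := by
  rw [lintegral_lam 0 hg, lintegral_lam 0 (g := fun z => g (c * z)) (by fun_prop)]
  have h := (rotation c).measurePreserving.setLIntegral_comp_preimage
    (Metric.isOpen_ball (x := (0 : ℂ)) (ε := 1)).measurableSet
    (f := fun z => ENNReal.ofReal ((1 - ‖z‖ ^ 2) ^ (2 * 0 - 2 : ℝ)) * g z) (by fun_prop)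
  rw [← h]
  have : (rotation c) ⁻¹' Metric.ball (0 : ℂ) 1 = Metric.ball 0 1 := by
    ext z; simp only [Set.mem_preimage, mem_ball_zero_iff, LinearIsometryEquiv.norm_map]
  rw [this]
  simp only [rotation_apply, norm_mul, Circle.norm_coe, one_mul]

/-! ### The exit area and its rescaling -/

/-- The set of points `z` with `|z| < r` which are mapped out of `D_r` by `z ↦ moebius z u`. -/
def exitSet (r : ℝ) (u : ℂ) : Set ℂ :=
  {z | ‖z‖ < r ∧ (1 - ‖z‖ ^ 2) * (1 - ‖u‖ ^ 2) ≤ (1 - r ^ 2) * ‖1 + conj z * u‖ ^ 2}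

/-- The hyperbolic area of `exitSet r u`. -/
def exitArea (r : ℝ) (u : ℂ) : ENNReal :=
  ∫⁻ z : Disk, (exitSet r u).indicator 1 (z : ℂ) ∂(lam 0)

lemma measurableSet_exitSet (r : ℝ) (u : ℂ) : MeasurableSet (exitSet r u) := by
  have h1 : IsOpen {z : ℂ | ‖z‖ < r} := isOpen_lt continuous_norm continuous_const
  have h2 : IsClosed {z : ℂ | (1 - ‖z‖ ^ 2) * (1 - ‖u‖ ^ 2) ≤
      (1 - r ^ 2) * ‖1 + conj z * u‖ ^ 2} := isClosed_le (by fun_prop) (by fun_prop)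
  exact h1.measurableSet.inter h2.measurableSet

lemma exitArea_eq_exitArea_norm (r : ℝ) (u : ℂ) : exitArea r u = exitArea r (‖u‖ : ℂ) := by
  obtain ⟨c, hc⟩ : ∃ c : Circle, u = c * (‖u‖ : ℂ) := by
    refine ⟨Circle.exp (Complex.arg u), ?_⟩
    rw [Circle.coe_exp, mul_comm]
    exact (Complex.norm_mul_exp_arg_mul_I u).symm
  have hcc : conj (c : ℂ) * c = 1 := by
    rw [Complex.conj_mul', Circle.norm_coe]; simp
  unfold exitArea
  rw [← lintegral_lam_zero_rotation c (measurable_one.indicator (measurableSet_exitSet r u))]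
  refine lintegral_congr fun z => ?_
  have : (c : ℂ) * z ∈ exitSet r u ↔ (z : ℂ) ∈ exitSet r (‖u‖ : ℂ) := by
    have e : 1 + conj ((c : ℂ) * z) * u = 1 + conj (z : ℂ) * ‖u‖ := by
      conv_lhs => rw [hc]
      rw [map_mul]
      linear_combination conj (z : ℂ) * ‖u‖ * hcc
    simp only [exitSet, Set.mem_ofPred_eq, e, norm_mul, Circle.norm_coe, one_mul,
      Complex.norm_real, norm_norm]
  by_cases h : (z : ℂ) ∈ exitSet r (‖u‖ : ℂ)
  · rw [Set.indicator_of_mem h, Set.indicator_of_mem (this.2 h)]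
    rfl
  · rw [Set.indicator_of_notMem h, Set.indicator_of_notMem (mt this.1 h)]

/-- The involution `s = ε / v` of `(ε, 1)` flattens `ε s^(-2) ds` to `dv`. The area, which blows up
near the unit circle, becomes a bounded density on a fixed interval. -/
lemma lintegral_Ioo_comp_div {ε : ℝ} (h0 : 0 < ε) (g : ℝ → ENNReal) :
    ∫⁻ s in Set.Ioo ε 1, ENNReal.ofReal (ε * s ^ (-2 : ℝ)) * g s =
      ∫⁻ v in Set.Ioo ε 1, g (ε / v) := by
  have himg : (fun v : ℝ => ε / v) '' Set.Ioo ε 1 = Set.Ioo ε 1 := by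
    have key : ∀ v ∈ Set.Ioo ε 1, ε / v ∈ Set.Ioo ε 1 := fun v hv => by
      have hv0 := h0.trans hv.1
      exact ⟨by rw [lt_div_iff₀ hv0]; nlinarith [hv.2], by rw [div_lt_one hv0]; exact hv.1⟩
    ext x
    constructor
    · rintro ⟨v, hv, rfl⟩
      exact key v hv
    · intro hx
      have hx0 := h0.trans hx.1
      exact ⟨ε / x, key x hx, by simp only; field_simp⟩
  have hder : ∀ v ∈ Set.Ioo ε 1, HasDerivWithinAt (fun v : ℝ => ε / v)
      (-ε / v ^ 2) (Set.Ioo ε 1) v := fun v hv => by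
    have hv0 := h0.trans hv.1
    have := ((hasDerivAt_inv hv0.ne').const_mul ε).hasDerivWithinAt (s := Set.Ioo ε 1)
    simp only [← div_eq_mul_inv] at this
    exact this.congr_deriv (by ring)
  have hinj : Set.InjOn (fun v : ℝ => ε / v) (Set.Ioo ε 1) := fun v hv w hw h => by
    have hv0 := h0.trans hv.1
    have hw0 := h0.trans hw.1
    have h' : ε / v = ε / w := h
    rw [div_eq_div_iff hv0.ne' hw0.ne'] at h'
    exact (mul_left_cancel₀ h0.ne' h').symm
  have := lintegral_image_eq_lintegral_abs_deriv_mul measurableSet_Ioo hder hinj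
    (fun s => ENNReal.ofReal (ε * s ^ (-2 : ℝ)) * g s)
  rw [himg] at this
  rw [this]
  refine setLIntegral_congr_fun measurableSet_Ioo fun v hv => ?_
  have hv0 := h0.trans hv.1
  rw [← mul_assoc, ← ENNReal.ofReal_mul (by positivity), abs_div, abs_neg, abs_of_pos h0,
    abs_of_pos (by positivity), show (-2 : ℝ) = -(2 : ℕ) by norm_num,
    Real.rpow_neg (by positivity), Real.rpow_natCast]
  have : ε / v ^ 2 * (ε * ((ε / v) ^ 2)⁻¹) = 1 := by field_simp
  rw [this, ENNReal.ofReal_one, one_mul]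

/-- The square modulus of `1 + a ρ e^{iθ}`. -/
def circleDistSq (a θ ρ : ℝ) : ℝ := 1 + 2 * a * ρ * Real.cos θ + (a * ρ) ^ 2

lemma circleDistSq_pos {a : ℝ} (ha : 0 ≤ a) (ha1 : a < 1) (θ : ℝ) : 0 < circleDistSq a θ 1 := by
  unfold circleDistSq
  nlinarith [Real.neg_one_le_cos θ, mul_nonneg ha (by linarith [Real.neg_one_le_cos θ] :
    0 ≤ 1 + Real.cos θ), sq_pos_of_pos (sub_pos.2 ha1)]

lemma norm_one_add_conj_polarPt_sq (a θ s : ℝ) :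
    ‖1 + conj (polarPt θ s) * (a : ℂ)‖ ^ 2 = circleDistSq a θ (Real.sqrt (1 - s)) := by
  rw [← Complex.normSq_eq_norm_sq, polarPt, circleDistSq, Complex.normSq_apply]
  simp [-Complex.ofReal_cos, -Complex.ofReal_sin]
  linear_combination (a * √(1 - s)) ^ 2 * Real.sin_sq_add_cos_sq θ

/-- The rescaled density of `exitArea` in polar coordinates. -/
def exitDensity (a ε θ v : ℝ) : ENNReal :=
  {p : ℝ × ℝ | ε < p.2 ∧ 1 - a ^ 2 ≤ p.2 * circleDistSq a p.1 (Real.sqrt (1 - ε / p.2))}.indicator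
    (fun _ => ENNReal.ofReal (1 / 2)) (θ, v)

lemma measurable_exitDensity (a ε : ℝ) : Measurable fun p : ℝ × ℝ => exitDensity a ε p.1 p.2 := by
  unfold exitDensity
  refine measurable_const.indicator ?_
  refine MeasurableSet.inter ?_ ?_
  · exact measurableSet_lt measurable_const measurable_snd
  · have h : Measurable fun p : ℝ × ℝ => p.2 * circleDistSq a p.1 (Real.sqrt (1 - ε / p.2)) := by
      unfold circleDistSq; fun_prop
    exact measurableSet_le measurable_const h

lemma exitDensity_le (a ε θ v : ℝ) : exitDensity a ε θ v ≤ 1 := by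
  unfold exitDensity
  refine (Set.indicator_le_self' (fun _ _ => zero_le) _).trans ?_
  rw [ENNReal.ofReal_le_one]; norm_num

lemma ofReal_mul_exitArea {r : ℝ} (hr0 : 0 < r) (hr1 : r < 1) (a : ℝ) :
    ENNReal.ofReal (1 - r ^ 2) * exitArea r (a : ℂ) =
      ∫⁻ θ in Set.Ioo (-Real.pi) Real.pi, ∫⁻ v in Set.Ioo (0 : ℝ) 1,
        exitDensity a (1 - r ^ 2) θ v := by
  have hε0 : 0 < 1 - r ^ 2 := by nlinarith
  have hm : Measurable ((exitSet r a).indicator (1 : ℂ → ENNReal)) :=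
    measurable_one.indicator (measurableSet_exitSet r a)
  rw [exitArea, lintegral_lam 0 hm, lintegral_ball_eq_polar (by fun_prop),
    ← lintegral_const_mul' _ _ ENNReal.ofReal_ne_top]
  refine lintegral_congr fun θ => ?_
  rw [← lintegral_const_mul' _ _ ENNReal.ofReal_ne_top]
  -- With `ε = 1 - r²`, the condition `|z| < r` reads `s > ε`, that is `v < 1`, while `s < 1` reads
  -- `v > ε`.
  have h1 := lintegral_Ioo_comp_div hε0 (fun s => ENNReal.ofReal (1 / 2) *
    {s : ℝ | s * (1 - a ^ 2) ≤ (1 - r ^ 2) * circleDistSq a θ (Real.sqrt (1 - s))}.indicator 1 s)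
  refine Eq.trans ?_ (h1.trans ?_)
  · rw [← lintegral_indicator measurableSet_Ioo, ← lintegral_indicator measurableSet_Ioo]
    refine lintegral_congr fun s => ?_
    by_cases hs : s ∈ Set.Ioo (0 : ℝ) 1
    · rw [Set.indicator_of_mem hs]
      have hlt : ‖polarPt θ s‖ < r ↔ 1 - r ^ 2 < s := by
        rw [norm_polarPt, Real.sqrt_lt' hr0]
        constructor <;> intro h <;> linarith
      simp only [exitSet, Set.indicator, Set.mem_ofPred_eq, norm_one_add_conj_polarPt_sq,
        one_sub_norm_polarPt_sq θ hs.2.le, Complex.norm_real, Real.norm_eq_abs, sq_abs, hlt,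
        Set.mem_Ioo, hs.2, and_true]
      by_cases h : 1 - r ^ 2 < s
      · simp only [h, true_and, if_true, Pi.one_apply]
        rw [ENNReal.ofReal_mul hε0.le, show (2 * 0 - 2 : ℝ) = -2 by norm_num]
        ring
      · simp [h]
    · rw [Set.indicator_of_notMem hs, Set.indicator_of_notMem]
      exact fun h => hs ⟨hε0.trans h.1, h.2⟩
  · rw [← lintegral_indicator measurableSet_Ioo, ← lintegral_indicator measurableSet_Ioo]
    refine lintegral_congr fun v => ?_
    by_cases hv : v ∈ Set.Ioo (1 - r ^ 2) 1
    · have hv0 := hε0.trans hv.1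
      rw [Set.indicator_of_mem hv, Set.indicator_of_mem (Set.mem_Ioo.2 ⟨hv0, hv.2⟩)]
      simp only [exitDensity, Set.indicator, Set.mem_ofPred_eq, hv.1, true_and]
      have : (1 - r ^ 2) / v * (1 - a ^ 2) ≤
          (1 - r ^ 2) * circleDistSq a θ (√(1 - (1 - r ^ 2) / v)) ↔
          1 - a ^ 2 ≤ v * circleDistSq a θ (√(1 - (1 - r ^ 2) / v)) := by
        rw [div_mul_eq_mul_div, mul_div_assoc, mul_le_mul_iff_right₀ hε0, div_le_iff₀' hv0]
      simp [this]
    · rw [Set.indicator_of_notMem hv]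
      symm
      rw [Set.indicator_apply_eq_zero]
      intro h
      rw [exitDensity, Set.indicator_of_notMem]
      exact fun h' => hv ⟨h'.1, h.2⟩

/-- Off the threshold the limiting inequality is strict, so the density is eventually constant as `ε
→ 0`. -/
lemma tendsto_exitDensity {a : ℝ} (ha : 0 ≤ a) (ha1 : a < 1) (θ : ℝ) {v : ℝ} (hv : 0 < v)
    (hne : v ≠ (1 - a ^ 2) / circleDistSq a θ 1) :
    Tendsto (fun ε => exitDensity a ε θ v) (𝓝[>] 0)
      (𝓝 ((Set.Ici ((1 - a ^ 2) / circleDistSq a θ 1)).indicator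
        (fun _ => ENNReal.ofReal (1 / 2)) v)) := by
  have hq := circleDistSq_pos ha ha1 θ
  have hc : Tendsto (fun ε : ℝ => v * circleDistSq a θ (Real.sqrt (1 - ε / v))) (𝓝[>] 0)
      (𝓝 (v * circleDistSq a θ 1)) := by
    have : Continuous fun ε : ℝ => v * circleDistSq a θ (Real.sqrt (1 - ε / v)) := by
      unfold circleDistSq; fun_prop
    have h := this.tendsto 0
    simp only [zero_div, sub_zero, Real.sqrt_one] at h
    exact h.mono_left nhdsWithin_le_nhds
  have hε : ∀ᶠ ε : ℝ in 𝓝[>] 0, ε < v := nhdsWithin_le_nhds (gt_mem_nhds hv)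
  refine tendsto_const_nhds.congr' ?_
  rcases hne.lt_or_gt with h | h
  · rw [Set.indicator_of_notMem (by simpa using h)]
    rw [lt_div_iff₀ hq] at h
    filter_upwards [hc.eventually_lt_const h] with ε h1
    rw [exitDensity, Set.indicator_of_notMem]
    exact fun h' => absurd h'.2 (not_le.2 h1)
  · rw [Set.indicator_of_mem (Set.mem_Ici.2 h.le)]
    rw [div_lt_iff₀ hq] at h
    filter_upwards [hc.eventually_const_lt h, hε] with ε h1 h2
    rw [exitDensity, Set.indicator_of_mem]
    exact ⟨h2, h1.le⟩

lemma lintegral_indicator_Ici_Ioo {c : ℝ} (hc : 0 < c) :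
    ∫⁻ v in Set.Ioo (0 : ℝ) 1, (Set.Ici c).indicator (fun _ => ENNReal.ofReal (1 / 2)) v =
      ENNReal.ofReal (1 / 2 * (1 - c)) := by
  rw [lintegral_indicator measurableSet_Ici, lintegral_const, Measure.restrict_restrict
    measurableSet_Ici, Measure.restrict_apply_univ]
  have : Set.Ici c ∩ Set.Ioo 0 1 = Set.Ico c 1 := by
    ext x; simp only [Set.mem_inter_iff, Set.mem_Ici, Set.mem_Ioo, Set.mem_Ico]
    constructor
    · rintro ⟨h1, h2, h3⟩; exact ⟨h1, h3⟩
    · rintro ⟨h1, h3⟩; exact ⟨h1, hc.trans_le h1, h3⟩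
  rw [this, Real.volume_Ico, ENNReal.ofReal_mul (by norm_num)]

lemma two_mul_arcsin_eq_arccos {a : ℝ} (ha : 0 ≤ a) (ha1 : a ≤ 1) :
    2 * Real.arcsin a = Real.arccos (1 - 2 * a ^ 2) := by
  have h : Real.cos (2 * Real.arcsin a) = 1 - 2 * a ^ 2 := by
    rw [Real.cos_two_mul, Real.cos_sq', Real.sin_arcsin (by linarith) ha1]; ring
  rw [← h, Real.arccos_cos]
  · linarith [Real.arcsin_nonneg.2 ha]
  · linarith [Real.arcsin_le_pi_div_two a]

/-- The arctangent is `arg(1 + a e^{iθ})`, whose derivative is the real part of `a e^{iθ} / (1 + a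
e^{iθ})`; this is half of one minus a Poisson kernel. -/
lemma hasDerivAt_arctan_circle {a : ℝ} (ha : 0 ≤ a) (ha1 : a < 1) (θ : ℝ) :
    HasDerivAt (fun θ => Real.arctan (a * Real.sin θ / (1 + a * Real.cos θ)))
      (1 / 2 * (1 - (1 - a ^ 2) / circleDistSq a θ 1)) θ := by
  have hq := circleDistSq_pos ha ha1 θ
  have hD : 0 < 1 + a * Real.cos θ := by nlinarith [Real.neg_one_le_cos θ]
  have h := (((Real.hasDerivAt_sin θ).const_mul a).fun_div
    (((Real.hasDerivAt_cos θ).const_mul a).const_add 1) hD.ne').arctan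
  refine h.congr_deriv ?_
  have e : 1 + (a * Real.sin θ / (1 + a * Real.cos θ)) ^ 2 =
      circleDistSq a θ 1 / (1 + a * Real.cos θ) ^ 2 := by
    unfold circleDistSq
    field_simp
    linear_combination a ^ 2 * Real.sin_sq_add_cos_sq θ
  rw [e]
  field_simp
  unfold circleDistSq
  linear_combination 2 * a ^ 2 * Real.sin_sq_add_cos_sq θ

lemma lintegral_one_sub_poisson {a : ℝ} (ha : 0 ≤ a) (ha1 : a < 1) :
    ∫⁻ θ in Set.Ioo (-Real.pi) Real.pi,
      ENNReal.ofReal (1 / 2 * (1 - (1 - a ^ 2) / circleDistSq a θ 1)) =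
      ENNReal.ofReal (Real.arccos (1 - 2 * a ^ 2)) := by
  -- The integrand has the sign of `a (cos θ + a)`, so for `|θ| < π` its positive part lives on `|θ|
  -- ≤ arccos(-a)`; `ENNReal.ofReal` discards the rest.
  set t := Real.arccos (-a) with ht
  have ht0 : 0 < t := Real.arccos_pos.2 (by linarith)
  have htpi : t ≤ Real.pi := Real.arccos_le_pi _
  have hcos : Real.cos t = -a := Real.cos_arccos (by linarith) (by linarith)
  have hcont : Continuous fun θ => 1 / 2 * (1 - (1 - a ^ 2) / circleDistSq a θ 1) := by
    have : ∀ θ, circleDistSq a θ 1 ≠ 0 := fun θ => (circleDistSq_pos ha ha1 θ).ne'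
    have h2 : Continuous fun θ => circleDistSq a θ 1 := by unfold circleDistSq; fun_prop
    fun_prop (disch := assumption)
  have hsign : ∀ θ, 1 / 2 * (1 - (1 - a ^ 2) / circleDistSq a θ 1) =
      a * (Real.cos θ + a) / circleDistSq a θ 1 := fun θ => by
    have := circleDistSq_pos ha ha1 θ
    field_simp
    unfold circleDistSq
    ring
  have hsub : Set.Ioo (-t) t ⊆ Set.Ioo (-Real.pi) Real.pi :=
    Set.Ioo_subset_Ioo (by linarith) htpi
  have hpos : ∀ θ ∈ Set.Ioo (-t) t, 0 ≤ 1 / 2 * (1 - (1 - a ^ 2) / circleDistSq a θ 1) := by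
    intro θ hθ
    rw [hsign]
    have h1 : -a ≤ Real.cos θ := by
      rw [← hcos, ← Real.cos_abs θ]
      exact Real.cos_le_cos_of_nonneg_of_le_pi (abs_nonneg _) htpi (abs_lt.2 hθ).le
    exact div_nonneg (mul_nonneg ha (by linarith)) (circleDistSq_pos ha ha1 θ).le
  have hneg : ∀ θ ∈ Set.Ioo (-Real.pi) Real.pi \ Set.Ioo (-t) t,
      ENNReal.ofReal (1 / 2 * (1 - (1 - a ^ 2) / circleDistSq a θ 1)) = 0 := by
    rintro θ ⟨hθ, hθ'⟩
    rw [hsign, ENNReal.ofReal_eq_zero]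
    have h1 : Real.cos θ ≤ -a := by
      rw [← hcos, ← Real.cos_abs θ]
      refine Real.cos_le_cos_of_nonneg_of_le_pi ht0.le (abs_lt.2 hθ).le ?_
      by_contra h
      exact hθ' (abs_lt.1 (not_le.1 h))
    exact div_nonpos_of_nonpos_of_nonneg (mul_nonpos_of_nonneg_of_nonpos ha (by linarith))
      (circleDistSq_pos ha ha1 θ).le
  rw [← lintegral_inter_add_sdiff (hB := measurableSet_Ioo (a := -t) (b := t)),
    Set.inter_eq_right.2 hsub,
    setLIntegral_congr_fun (measurableSet_Ioo.diff measurableSet_Ioo) hneg, lintegral_zero,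
    add_zero, ← ofReal_integral_eq_lintegral_ofReal
      (hcont.integrableOn_Icc.mono_set Set.Ioo_subset_Icc_self)
      ((ae_restrict_mem measurableSet_Ioo).mono hpos),
    ← integral_Ioc_eq_integral_Ioo, ← intervalIntegral.integral_of_le (by linarith),
    intervalIntegral.integral_eq_sub_of_hasDerivAt
      (fun θ _ => hasDerivAt_arctan_circle ha ha1 θ) (hcont.intervalIntegrable _ _)]
  congr 1
  have hs : 0 < 1 - a ^ 2 := by nlinarith
  -- At the endpoint `t` the argument of the arctangent is `a / √(1 - a²) = tan(arcsin a)`; the two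
  -- endpoints together give `2 arcsin a`.
  have h2 : a * √(1 - a ^ 2) / (1 + a * -a) = a / √(1 - a ^ 2) := by
    have h3 := Real.sq_sqrt hs.le
    have h4 := Real.sqrt_pos.2 hs
    rw [div_eq_div_iff (by nlinarith) h4.ne']
    linear_combination a * h3
  rw [Real.sin_neg, Real.cos_neg, hcos, ht, Real.sin_arccos, neg_sq, mul_neg a (√_), neg_div,
    Real.arctan_neg, sub_neg_eq_add, ← two_mul, h2, ← two_mul_arcsin_eq_arccos ha ha1.le,
    Real.arcsin_eq_arctan ⟨by linarith, ha1⟩]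

lemma tendsto_ofReal_mul_exitArea {u : ℂ} (hu : ‖u‖ < 1) :
    Tendsto (fun r : ℝ => ENNReal.ofReal (1 - r ^ 2) * exitArea r u) (𝓝[<] 1)
      (𝓝 (ENNReal.ofReal (Real.arccos (1 - 2 * ‖u‖ ^ 2)))) := by
  set a := ‖u‖
  have ha : 0 ≤ a := norm_nonneg u
  have hlim : Tendsto (fun ε : ℝ => ∫⁻ θ in Set.Ioo (-Real.pi) Real.pi,
      ∫⁻ v in Set.Ioo (0 : ℝ) 1, exitDensity a ε θ v) (𝓝[>] 0)
      (𝓝 (ENNReal.ofReal (Real.arccos (1 - 2 * a ^ 2)))) := by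
    rw [← lintegral_one_sub_poisson ha hu]
    refine tendsto_lintegral_filter_of_dominated_convergence (fun _ => 1)
      (.of_forall fun ε => (measurable_exitDensity a ε).lintegral_prod_right') ?_ ?_ ?_
    · refine .of_forall fun ε => .of_forall fun θ => ?_
      refine (lintegral_mono fun v => exitDensity_le a ε θ v).trans ?_
      simp
    · simp
    · refine .of_forall fun θ => ?_
      rw [← lintegral_indicator_Ici_Ioo
        (div_pos (by nlinarith : 0 < 1 - a ^ 2) (circleDistSq_pos ha hu θ))]
      refine tendsto_lintegral_filter_of_dominated_convergence (fun _ => 1)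
        (.of_forall fun ε => (measurable_exitDensity a ε).comp measurable_prodMk_left) ?_ ?_ ?_
      · exact .of_forall fun ε => .of_forall fun v => exitDensity_le a ε θ v
      · simp
      · filter_upwards [ae_restrict_mem measurableSet_Ioo,
          ae_restrict_of_ae (Measure.ae_ne volume ((1 - a ^ 2) / circleDistSq a θ 1))] with v h1 h2
        exact tendsto_exitDensity ha hu θ h1.1 h2
  have hr : Tendsto (fun r : ℝ => 1 - r ^ 2) (𝓝[<] 1) (𝓝[>] 0) := by
    refine tendsto_nhdsWithin_iff.2 ⟨?_, ?_⟩
    · have : Continuous fun r : ℝ => 1 - r ^ 2 := by fun_prop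
      have h := this.tendsto 1
      norm_num at h
      exact h.mono_left nhdsWithin_le_nhds
    · filter_upwards [Ioo_mem_nhdsLT (zero_lt_one (α := ℝ))] with r hr
      have := hr.1; have := hr.2
      simp only [Set.mem_Ioi]; nlinarith
  refine (hlim.comp hr).congr' ?_
  filter_upwards [Ioo_mem_nhdsLT (zero_lt_one (α := ℝ))] with r hr
  rw [exitArea_eq_exitArea_norm, ofReal_mul_exitArea hr.1 hr.2]
  rfl

lemma ofReal_mul_exitArea_le {r : ℝ} (hr0 : 0 < r) (hr1 : r < 1) (u : ℂ) :
    ENNReal.ofReal (1 - r ^ 2) * exitArea r u ≤ ENNReal.ofReal (2 * Real.pi) := by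
  rw [exitArea_eq_exitArea_norm, ofReal_mul_exitArea hr0 hr1]
  calc _ ≤ ∫⁻ θ in Set.Ioo (-Real.pi) Real.pi, ∫⁻ v in Set.Ioo (0 : ℝ) 1, 1 :=
        lintegral_mono fun θ => lintegral_mono fun v => exitDensity_le _ _ θ v
    _ ≤ _ := by
      simp only [lintegral_one, Measure.restrict_apply_univ, Real.volume_Ioo, sub_zero,
        ENNReal.ofReal_one]
      gcongr; linarith

/-! ### Counting statistics of determinantal processes -/

section DeterminantalVariance

variable {E : Type*} [TopologicalSpace E]

open Classical in
-- The nonzero terms are the injections of `Fin n` into the finite set `X ∩ A`, so indicators of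
-- `A^n` give access to the factorial moments of the count.
lemma Conf.tupleSum_indicator {A : Set E} {X : Conf E} (hfin : (X.1 ∩ A).Finite) (n : ℕ) :
    Conf.tupleSum ({x : Fin n → E | ∀ i, x i ∈ A}.indicator 1) X =
      ((Conf.count A X).descFactorial n : ℂ) := by
  have : Fintype (X.1 ∩ A : Set E) := hfin.fintype
  let T : Set (Fin n ↪ X.1) := {x | ∀ i, (x i : E) ∈ A}
  let e : T ≃ (Fin n ↪ (X.1 ∩ A : Set E)) :=
    { toFun := fun x => ⟨fun i => ⟨x.1 i, (x.1 i).2, x.2 i⟩, fun i j h =>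
        x.1.injective (Subtype.ext (Subtype.mk.inj h))⟩
      invFun := fun y => ⟨⟨fun i => ⟨y i, (y i).2.1⟩, fun i j h =>
        y.injective (Subtype.ext (Subtype.mk.inj h))⟩, fun i => (y i).2.2⟩
      left_inv := fun x => rfl
      right_inv := fun y => rfl }
  have h1 : Conf.tupleSum ({x : Fin n → E | ∀ i, x i ∈ A}.indicator 1) X =
      ∑' x : Fin n ↪ X.1, T.indicator (fun _ => (1 : ℂ)) x := by
    unfold Conf.tupleSum
    congr 1
  rw [h1, ← tsum_subtype, tsum_const, Nat.card_congr e, Nat.card_eq_fintype_card,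
    Fintype.card_embedding_eq, Fintype.card_fin, Conf.count, Set.ncard_eq_toFinset_card',
    Set.toFinset_card, nsmul_eq_mul, mul_one]

lemma Conf.finite_inter {A : Set E} (hAc : IsCompact (closure A)) (X : Conf E) : (X.1 ∩ A).Finite :=
  (X.2 _ hAc).subset (Set.inter_subset_inter_right _ subset_closure)

variable [MeasurableSpace E] {K : E → E → ℂ} {μ : Measure E} {P : Measure (Conf E)} {A : Set E}

lemma IsDeterminantal.descFactorial [T2Space E] (hP : IsDeterminantal K μ P)
    (hA : MeasurableSet A) (hAc : IsCompact (closure A)) (n : ℕ) :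
    Integrable (fun X => ((Conf.count A X).descFactorial n : ℂ)) P ∧
      ∫ X, ((Conf.count A X).descFactorial n : ℂ) ∂P =
        ∫ x in {x : Fin n → E | ∀ i, x i ∈ A}, (Matrix.of fun i j => K (x i) (x j)).det
          ∂(Measure.pi fun _ => μ) := by
  have hS : MeasurableSet {x : Fin n → E | ∀ i, x i ∈ A} := by
    rw [Set.ofPred_forall]
    exact MeasurableSet.iInter fun i => measurable_pi_apply i hA
  have hm : Measurable ({x : Fin n → E | ∀ i, x i ∈ A}.indicator (1 : (Fin n → E) → ℂ)) :=
    measurable_one.indicator hS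
  have hc : HasCompactSupport ({x : Fin n → E | ∀ i, x i ∈ A}.indicator
      (1 : (Fin n → E) → ℂ)) := by
    refine HasCompactSupport.intro (isCompact_univ_pi fun _ : Fin n => hAc) fun x hx => ?_
    refine Set.indicator_of_notMem (fun (h : ∀ i, x i ∈ A) => hx fun i _ => subset_closure (h i)) _
  have hb : ∃ B : ℝ, ∀ x, ‖{x : Fin n → E | ∀ i, x i ∈ A}.indicator
      (1 : (Fin n → E) → ℂ) x‖ ≤ B :=
    ⟨1, fun x => (norm_indicator_le_norm_self _ x).trans (by simp)⟩
  have e : Conf.tupleSum ({x : Fin n → E | ∀ i, x i ∈ A}.indicator 1) =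
      fun X => ((Conf.count A X).descFactorial n : ℂ) :=
    funext fun X => Conf.tupleSum_indicator (Conf.finite_inter hAc X) n
  have h1 := hP.integrable_tupleSum n _ hm hc hb
  have h2 := hP.integral_tupleSum n _ hm hc hb
  rw [e] at h1 h2
  refine ⟨h1, h2.trans ?_⟩
  rw [← integral_indicator hS]
  congr 1; ext x
  by_cases hx : x ∈ {x : Fin n → E | ∀ i, x i ∈ A}
  · rw [Set.indicator_of_mem hx, Set.indicator_of_mem hx, Pi.one_apply, one_mul]
  · rw [Set.indicator_of_notMem hx, Set.indicator_of_notMem hx, zero_mul]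

lemma IsDeterminantal.integrable_descFactorial_real [T2Space E] (hP : IsDeterminantal K μ P)
    (hA : MeasurableSet A) (hAc : IsCompact (closure A)) (n : ℕ) :
    Integrable (fun X => ((Conf.count A X).descFactorial n : ℝ)) P := by
  simpa using (hP.descFactorial hA hAc n).1.re

lemma natCast_sq_eq_descFactorial (N : ℕ) :
    (N : ℝ) ^ 2 = (N.descFactorial 2 : ℝ) + (N.descFactorial 1 : ℝ) := by
  rcases N with _ | N
  · simp
  · simp [Nat.descFactorial]; ring

lemma IsDeterminantal.memLp_count [T2Space E] (hP : IsDeterminantal K μ P)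
    (hA : MeasurableSet A) (hAc : IsCompact (closure A)) :
    MemLp (fun X => (Conf.count A X : ℝ)) 2 P := by
  have h1 := hP.integrable_descFactorial_real hA hAc 1
  have h2 := hP.integrable_descFactorial_real hA hAc 2
  have hm : AEStronglyMeasurable (fun X => (Conf.count A X : ℝ)) P := by
    simpa using h1.aestronglyMeasurable
  rw [memLp_two_iff_integrable_sq hm]
  simp only [natCast_sq_eq_descFactorial]
  exact h2.add h1

lemma IsDeterminantal.integral_count [T2Space E] [SigmaFinite μ] (hP : IsDeterminantal K μ P)
    (hA : MeasurableSet A) (hAc : IsCompact (closure A)) :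
    ((∫ X, (Conf.count A X : ℝ) ∂P : ℝ) : ℂ) = ∫ z in A, K z z ∂μ := by
  have h := (hP.descFactorial hA hAc 1).2
  simp only [Nat.descFactorial_one] at h
  rw [← integral_complex_ofReal]
  simp only [Complex.ofReal_natCast]
  rw [h]
  have hmp := measurePreserving_funUnique μ (Fin 1)
  have hpre : (MeasurableEquiv.funUnique (Fin 1) E) ⁻¹' A = {x : Fin 1 → E | ∀ i, x i ∈ A} := by
    ext x; simp
  rw [← hmp.setIntegral_preimage_emb (MeasurableEquiv.funUnique (Fin 1) E).measurableEmbedding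
    (fun z => K z z) A, hpre]
  simp only [Matrix.det_unique, Matrix.of_apply]
  rfl

lemma IsDeterminantal.integral_descFactorial_two [T2Space E] [SigmaFinite μ]
    (hP : IsDeterminantal K μ P) (hA : MeasurableSet A) (hAc : IsCompact (closure A)) :
    ((∫ X, ((Conf.count A X).descFactorial 2 : ℝ) ∂P : ℝ) : ℂ) =
      ∫ p in A ×ˢ A, (K p.1 p.1 * K p.2 p.2 - K p.1 p.2 * K p.2 p.1) ∂(μ.prod μ) := by
  have h := (hP.descFactorial hA hAc 2).2
  rw [← integral_complex_ofReal]
  simp only [Complex.ofReal_natCast]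
  rw [h]
  have hmp := measurePreserving_finTwoArrow μ
  have hpre : (MeasurableEquiv.finTwoArrow) ⁻¹' (A ×ˢ A) = {x : Fin 2 → E | ∀ i, x i ∈ A} := by
    ext x; simp [Fin.forall_fin_two]
  rw [← hmp.setIntegral_preimage_emb MeasurableEquiv.finTwoArrow.measurableEmbedding
    (fun p => K p.1 p.1 * K p.2 p.2 - K p.1 p.2 * K p.2 p.1) (A ×ˢ A), hpre]
  simp [Matrix.det_fin_two]

/-- The number variance of a determinantal point process. -/
lemma IsDeterminantal.variance_count [T2Space E] [SigmaFinite μ] (hP : IsDeterminantal K μ P)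
    (hA : MeasurableSet A) (hAc : IsCompact (closure A))
    (h1 : IntegrableOn (fun z => K z z) A μ)
    (h2 : IntegrableOn (fun p : E × E => K p.1 p.2 * K p.2 p.1) (A ×ˢ A) (μ.prod μ)) :
    ((Var[fun X => (Conf.count A X : ℝ); P] : ℝ) : ℂ) =
      (∫ z in A, K z z ∂μ) - ∫ p in A ×ˢ A, K p.1 p.2 * K p.2 p.1 ∂(μ.prod μ) := by
  have := hP.isProbabilityMeasure
  have hN := hP.integrable_descFactorial_real hA hAc 1
  have hN2 := hP.integrable_descFactorial_real hA hAc 2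
  have e : ∫ X, (Conf.count A X : ℝ) ^ 2 ∂P = ∫ X, ((Conf.count A X).descFactorial 2 : ℝ) ∂P +
      ∫ X, (Conf.count A X : ℝ) ∂P := by
    simp only [natCast_sq_eq_descFactorial]
    rw [integral_add hN2 hN]
    simp
  rw [variance_eq_sub (hP.memLp_count hA hAc)]
  have e' : P[(fun X => (Conf.count A X : ℝ)) ^ 2] = ∫ X, (Conf.count A X : ℝ) ^ 2 ∂P := rfl
  have hprod : IntegrableOn (fun p : E × E => K p.1 p.1 * K p.2 p.2) (A ×ˢ A) (μ.prod μ) := by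
    rw [IntegrableOn, ← Measure.prod_restrict]
    exact h1.mul_prod h1
  rw [e', e]
  push_cast
  rw [hP.integral_descFactorial_two hA hAc, hP.integral_count hA hAc, integral_sub hprod h2,
    setIntegral_prod_mul (fun z => K z z) (fun z => K z z)]
  ring

end DeterminantalVariance

/-! ### Finiteness and change of weight for `lam ν` -/

instance isFiniteMeasure_comap_disk : IsFiniteMeasure (Measure.comap ((↑) : Disk → ℂ) volume) :=
  ⟨by
    rw [(MeasurableEmbedding.subtype_coe Metric.isOpen_ball.measurableSet).comap_apply,
      Set.image_univ, Subtype.range_coe]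
    exact measure_ball_lt_top⟩

instance sigmaFinite_lam (ν : ℝ) : SigmaFinite (lam ν) :=
  SigmaFinite.withDensity_ofReal _

lemma one_sub_norm_sq_disk_pos (z : Disk) : 0 < 1 - ‖(z : ℂ)‖ ^ 2 := one_sub_norm_sq_pos z.2

lemma norm_disk_lt_one (z : Disk) : ‖(z : ℂ)‖ < 1 := mem_ball_zero_iff.1 z.2

lemma lam_eq_withDensity (ν : ℝ) : lam ν =
    (lam 0).withDensity fun z => ENNReal.ofReal ((1 - ‖(z : ℂ)‖ ^ 2) ^ (2 * ν)) := by
  rw [lam, lam, ← withDensity_mul _ (by fun_prop) (by fun_prop)]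
  congr 1; ext z
  have h := one_sub_norm_sq_disk_pos z
  rw [Pi.mul_apply, ← ENNReal.ofReal_mul (by positivity), ← Real.rpow_add h]
  congr 2; ring

lemma setLIntegral_lam_eq (ν : ℝ) {s : Set Disk} (hs : MeasurableSet s) {g : Disk → ENNReal}
    (hg : Measurable g) : ∫⁻ z in s, g z ∂(lam ν) =
      ∫⁻ z in s, ENNReal.ofReal ((1 - ‖(z : ℂ)‖ ^ 2) ^ (2 * ν)) * g z ∂(lam 0) := by
  rw [lam_eq_withDensity, setLIntegral_withDensity_eq_setLIntegral_mul _ (by fun_prop) hg hs]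
  rfl

lemma measurableSet_discD (r : ℝ) : MeasurableSet (discD r) :=
  measurableSet_lt (by fun_prop) measurable_const

lemma isCompact_closure_discD {r : ℝ} (hr : r < 1) : IsCompact (closure (discD r)) := by
  have hK : IsCompact {z : Disk | ‖(z : ℂ)‖ ≤ r} := by
    rw [Subtype.isCompact_iff]
    have : ((↑) : Disk → ℂ) '' {z : Disk | ‖(z : ℂ)‖ ≤ r} = Metric.closedBall 0 r := by
      ext z
      simp only [Set.mem_image, Set.mem_ofPred_eq, mem_closedBall_zero_iff]
      constructor
      · rintro ⟨w, hw, rfl⟩; exact hw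
      · exact fun hz => ⟨⟨z, mem_ball_zero_iff.2 (hz.trans_lt hr)⟩, hz, rfl⟩
    rw [this]
    exact isCompact_closedBall 0 r
  exact hK.of_isClosed_subset isClosed_closure
    (closure_minimal (fun z (hz : ‖(z : ℂ)‖ < r) => hz.le) hK.isClosed)

lemma lam_zero_discD_lt_top {r : ℝ} (hr0 : 0 < r) (hr : r < 1) : lam 0 (discD r) < ⊤ := by
  have hpos : 0 < 1 - r ^ 2 := by nlinarith
  rw [lam, withDensity_apply _ (measurableSet_discD r)]
  calc _ ≤ ∫⁻ z in discD r, ENNReal.ofReal ((1 - r ^ 2) ^ (2 * 0 - 2 : ℝ))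
        ∂(Measure.comap ((↑) : Disk → ℂ) volume) := by
        refine setLIntegral_mono measurable_const fun z (hz : ‖(z : ℂ)‖ < r) => ?_
        refine ENNReal.ofReal_le_ofReal (Real.rpow_le_rpow_of_nonpos hpos ?_ (by norm_num))
        nlinarith [norm_nonneg (z : ℂ)]
    _ < ⊤ := by
        rw [setLIntegral_const]
        exact ENNReal.mul_lt_top ENNReal.ofReal_lt_top (measure_lt_top _ _)

/-! ### The kernel -/

/-- The quantity `1 / cosh² d(z, w)`. -/
@[irreducible]
def invCoshSq (z w : ℂ) : ℝ := (1 - ‖z‖ ^ 2) * (1 - ‖w‖ ^ 2) / ‖1 - z * conj w‖ ^ 2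

/-- The function `f_{ν,m}` in the variable `1 / cosh² x`. -/
@[irreducible]
def landauDensity (ν : ℝ) (m : ℕ) (s : ℝ) : ℝ :=
  ((2 * (ν - m) - 1) / Real.pi * s ^ (ν - m) * jacobiP 0 (2 * (ν - m) - 1) m (2 * s - 1)) ^ 2

lemma landauDensity_nonneg (ν : ℝ) (m : ℕ) (s : ℝ) : 0 ≤ landauDensity ν m s := by
  rw [landauDensity]
  exact sq_nonneg _

lemma measurable_landauDensity (ν : ℝ) (m : ℕ) : Measurable (landauDensity ν m) := by
  have h : Measurable (jacobiP 0 (2 * (ν - m) - 1) m) := (continuous_jacobiP _ _ _).measurable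
  unfold landauDensity
  fun_prop

lemma measurable_invCoshSq : Measurable fun p : ℂ × ℂ => invCoshSq p.1 p.2 := by
  unfold invCoshSq; fun_prop

lemma measurable_landauDensity_invCoshSq (ν : ℝ) (m : ℕ) :
    Measurable fun p : ℂ × ℂ => ENNReal.ofReal (landauDensity ν m (invCoshSq p.1 p.2)) :=
  ((measurable_landauDensity ν m).comp measurable_invCoshSq).ennreal_ofReal

lemma measurable_landauDensity_invCoshSq_right (ν : ℝ) (m : ℕ) (z : ℂ) :
    Measurable fun w : ℂ => ENNReal.ofReal (landauDensity ν m (invCoshSq z w)) :=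
  (measurable_landauDensity_invCoshSq ν m).comp
    (measurable_prodMk_left : Measurable fun w : ℂ => (z, w))

lemma measurable_landauDensity_radial (ν : ℝ) (m : ℕ) :
    Measurable fun z : Disk => ENNReal.ofReal (landauDensity ν m (1 - ‖(z : ℂ)‖ ^ 2)) := by
  have h : Measurable fun z : Disk => 1 - ‖(z : ℂ)‖ ^ 2 := by fun_prop
  exact ((measurable_landauDensity ν m).comp h).ennreal_ofReal

lemma norm_one_sub_mul_conj_comm (z w : ℂ) : ‖1 - z * conj w‖ = ‖1 - w * conj z‖ := by
  rw [← Complex.norm_conj]; simp [mul_comm]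

/-- `invCoshSq z w` is `1 - |moebius (-z) w|²`, and `moebius (-z)` undoes `moebius z`. -/
lemma invCoshSq_moebius {z u : ℂ} (hz : ‖z‖ < 1) (hu : ‖u‖ < 1) :
    invCoshSq z (moebius z u) = 1 - ‖u‖ ^ 2 := by
  have hz' : ‖-z‖ < 1 := by rwa [norm_neg]
  have h := one_sub_norm_moebius_sq hz' (norm_moebius_lt_one hz hu)
  rw [moebius_neg_moebius hz hu, norm_neg] at h
  rw [h, invCoshSq, norm_one_sub_mul_conj_comm, map_neg, neg_mul, ← sub_eq_add_neg,
    mul_comm (conj z)]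

/-- In the coordinate `s` the integrand is `(a/π)² s^(a-1)` times the squared Jacobi polynomial, so
the norm formula with `b = a` gives `π · (a/π)² · 1/a`. -/
lemma lintegral_landauDensity_radial {ν : ℝ} {m : ℕ} (ha : 0 < 2 * (ν - m) - 1) :
    ∫⁻ z : Disk, ENNReal.ofReal (landauDensity ν m (1 - ‖(z : ℂ)‖ ^ 2)) ∂(lam 0) =
      ENNReal.ofReal ((2 * (ν - m) - 1) / Real.pi) := by
  have hm := measurable_landauDensity ν m
  set a := 2 * (ν - m) - 1 with ha_def
  rw [lintegral_lam_zero_radial (g := fun s => ENNReal.ofReal (landauDensity ν m s))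
    (by fun_prop)]
  have : ∫⁻ s in Set.Ioo (0 : ℝ) 1, ENNReal.ofReal (s ^ (-2 : ℝ)) *
      ENNReal.ofReal (landauDensity ν m s) =
      ENNReal.ofReal ((a / Real.pi) ^ 2) * ENNReal.ofReal (1 / a) := by
    rw [← lintegral_rpow_mul_jacobiP_sq ha m, ← lintegral_const_mul' _ _ ENNReal.ofReal_ne_top]
    refine setLIntegral_congr_fun measurableSet_Ioo fun s hs => ?_
    have hs0 := hs.1
    rw [← ENNReal.ofReal_mul (by positivity), ← ENNReal.ofReal_mul (by positivity)]
    congr 1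
    have e : s ^ (a - 1) = s ^ (-2 : ℝ) * (s ^ (ν - m) * s ^ (ν - m)) := by
      rw [← Real.rpow_add hs0, ← Real.rpow_add hs0]; congr 1; rw [ha_def]; ring
    rw [landauDensity, e]
    ring
  rw [this, ← ENNReal.ofReal_mul (by positivity), ← ENNReal.ofReal_mul (by positivity)]
  congr 1
  have := Real.pi_pos
  field_simp

lemma lintegral_landauDensity_invCoshSq {ν : ℝ} {m : ℕ} (ha : 0 < 2 * (ν - m) - 1) {z : ℂ}
    (hz : ‖z‖ < 1) :
    ∫⁻ w : Disk, ENNReal.ofReal (landauDensity ν m (invCoshSq z w)) ∂(lam 0) =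
      ENNReal.ofReal ((2 * (ν - m) - 1) / Real.pi) := by
  rw [← lintegral_comp_moebius hz (measurable_landauDensity_invCoshSq_right ν m z), ← lintegral_landauDensity_radial ha]
  refine lintegral_congr fun u => ?_
  rw [invCoshSq_moebius hz (norm_disk_lt_one u)]

/-- The square modulus of the kernel. -/
@[irreducible]
def kernelNormSq (ν : ℝ) (m : ℕ) (z w : ℂ) : ℝ :=
  ((2 * (ν - m) - 1) / Real.pi * ‖1 - z * conj w‖ ^ (-2 * ν) * (invCoshSq z w)⁻¹ ^ m *
    jacobiP 0 (2 * (ν - m) - 1) m (2 * invCoshSq z w - 1)) ^ 2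

lemma kernelNormSq_nonneg (ν : ℝ) (m : ℕ) (z w : ℂ) : 0 ≤ kernelNormSq ν m z w := by
  rw [kernelNormSq]
  exact sq_nonneg _

lemma measurable_kernelNormSq (ν : ℝ) (m : ℕ) :
    Measurable fun p : ℂ × ℂ => kernelNormSq ν m p.1 p.2 := by
  have h : Measurable (jacobiP 0 (2 * (ν - m) - 1) m) := (continuous_jacobiP _ _ _).measurable
  have h2 := measurable_invCoshSq
  unfold kernelNormSq
  fun_prop

lemma one_sub_mul_conj_re_pos (z w : Disk) : 0 < (1 - (z : ℂ) * conj (w : ℂ)).re := by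
  have h1 : ‖(z : ℂ) * conj (w : ℂ)‖ < 1 := by
    rw [norm_mul, Complex.norm_conj]
    nlinarith [norm_nonneg (z : ℂ), norm_nonneg (w : ℂ), norm_disk_lt_one z, norm_disk_lt_one w]
  rw [Complex.sub_re, Complex.one_re]
  linarith [Complex.re_le_norm ((z : ℂ) * conj (w : ℂ))]

lemma kernelG_mul_kernelG_swap (ν : ℝ) (m : ℕ) (z w : Disk) :
    kernelG ν m z w * kernelG ν m w z = (kernelNormSq ν m z w : ℂ) := by
  have hre := one_sub_mul_conj_re_pos z w
  -- A base with positive real part lies off the branch cut, so the complex power commutes with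
  -- conjugation and the kernel is Hermitian.
  have harg : (1 - (z : ℂ) * conj (w : ℂ)).arg ≠ Real.pi := fun h => by
    rw [Complex.arg_eq_pi_iff] at h
    linarith [h.1]
  have hconj : 1 - (w : ℂ) * conj (z : ℂ) = conj (1 - (z : ℂ) * conj (w : ℂ)) := by
    simp [mul_comm]
  have hpow : (1 - (z : ℂ) * conj (w : ℂ)) ^ (-2 * (ν : ℂ)) *
      (1 - (w : ℂ) * conj (z : ℂ)) ^ (-2 * (ν : ℂ)) =
      (((‖1 - (z : ℂ) * conj (w : ℂ)‖ ^ (-2 * ν)) ^ 2 : ℝ) : ℂ) := by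
    have e : -2 * (ν : ℂ) = ((-2 * ν : ℝ) : ℂ) := by push_cast; ring
    rw [hconj, e, Complex.conj_cpow _ _ harg, Complex.conj_ofReal, Complex.mul_conj,
      Complex.normSq_eq_norm_sq, Complex.norm_cpow_real]
  have hn := norm_one_sub_mul_conj_comm (w : ℂ) (z : ℂ)
  have hi : ‖1 - (z : ℂ) * conj (w : ℂ)‖ ^ 2 / ((1 - ‖(z : ℂ)‖ ^ 2) * (1 - ‖(w : ℂ)‖ ^ 2)) =
      (invCoshSq z w)⁻¹ := by rw [invCoshSq, inv_div]
  unfold kernelG kernelNormSq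
  rw [hn, mul_comm (1 - ‖(w : ℂ)‖ ^ 2) (1 - ‖(z : ℂ)‖ ^ 2), hi, ← invCoshSq]
  push_cast at hpow ⊢
  linear_combination ((2 * ((ν : ℂ) - m) - 1) / Real.pi) ^ 2 * ((invCoshSq z w : ℂ)⁻¹ ^ m) ^ 2 *
    (jacobiP 0 (2 * (ν - m) - 1) m (2 * invCoshSq z w - 1) : ℂ) ^ 2 * hpow

/-- The weights supply the factor `(1 - |z|²)^ν (1 - |w|²)^ν` inside the square; combined with `|1 -
z w̄|^(-2ν)` it is `invCoshSq^ν`, and the `m`-th power lowers the exponent to `ν - m`. -/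
lemma rpow_mul_kernelNormSq (ν : ℝ) (m : ℕ) (z w : Disk) :
    (1 - ‖(z : ℂ)‖ ^ 2) ^ (2 * ν) * ((1 - ‖(w : ℂ)‖ ^ 2) ^ (2 * ν) * kernelNormSq ν m z w) =
      landauDensity ν m (invCoshSq z w) := by
  have hA := one_sub_norm_sq_disk_pos z
  have hB := one_sub_norm_sq_disk_pos w
  have hd : 0 < ‖1 - (z : ℂ) * conj (w : ℂ)‖ := norm_pos_iff.2 fun h => by
    have := one_sub_mul_conj_re_pos z w
    rw [h] at this
    simp at this
  have hs : 0 < invCoshSq z w := by unfold invCoshSq; positivity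
  have e : invCoshSq z w ^ (ν - m) = (1 - ‖(z : ℂ)‖ ^ 2) ^ ν * (1 - ‖(w : ℂ)‖ ^ 2) ^ ν *
      ‖1 - (z : ℂ) * conj (w : ℂ)‖ ^ (-2 * ν) * (invCoshSq z w)⁻¹ ^ m := by
    rw [Real.rpow_sub hs, Real.rpow_natCast, inv_pow, div_eq_mul_inv]
    congr 1
    rw [invCoshSq, Real.div_rpow (by positivity) (by positivity),
      Real.mul_rpow hA.le hB.le, neg_mul, Real.rpow_neg hd.le, Real.rpow_mul hd.le,
      Real.rpow_two, div_eq_mul_inv]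
  rw [landauDensity, kernelNormSq, e, mul_comm 2 ν, Real.rpow_mul hA.le, Real.rpow_mul hB.le,
    Real.rpow_two, Real.rpow_two]
  ring

lemma kernelG_self (ν : ℝ) (m : ℕ) (z : Disk) : kernelG ν m z z =
    (((2 * (ν - m) - 1) / Real.pi * (1 - ‖(z : ℂ)‖ ^ 2) ^ (-2 * ν) : ℝ) : ℂ) := by
  have hA := one_sub_norm_sq_disk_pos z
  have e : 1 - (z : ℂ) * conj (z : ℂ) = ((1 - ‖(z : ℂ)‖ ^ 2 : ℝ) : ℂ) := by
    rw [Complex.mul_conj']; push_cast; ring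
  have e2 : -2 * (ν : ℂ) = ((-2 * ν : ℝ) : ℂ) := by push_cast; ring
  have e3 : (1 - ‖(z : ℂ)‖ ^ 2) ^ 2 / ((1 - ‖(z : ℂ)‖ ^ 2) * (1 - ‖(z : ℂ)‖ ^ 2)) = 1 := by
    field_simp
  have e4 : (1 - ‖(z : ℂ)‖ ^ 2) * (1 - ‖(z : ℂ)‖ ^ 2) / (1 - ‖(z : ℂ)‖ ^ 2) ^ 2 = 1 := by
    field_simp
  rw [kernelG, e, e2, ← Complex.ofReal_cpow hA.le, Complex.norm_real, Real.norm_eq_abs,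
    abs_of_pos hA, e3, e4, one_pow, show (2 * 1 - 1 : ℝ) = 1 by norm_num, jacobiP_zero_one]
  push_cast
  ring

/-! ### The variance -/

/-- The integral over `D_r × D_rᶜ` of the invariant square modulus of the kernel. -/
def crossIntegral (ν : ℝ) (m : ℕ) (r : ℝ) : ENNReal :=
  ∫⁻ z in discD r, ∫⁻ w in (discD r)ᶜ, ENNReal.ofReal (landauDensity ν m (invCoshSq z w))
    ∂(lam 0) ∂(lam 0)

lemma integrableOn_kernelG_self {ν : ℝ} {m : ℕ} (ha : 0 < 2 * (ν - m) - 1) {r : ℝ} (hr0 : 0 < r)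
    (hr1 : r < 1) : IntegrableOn (fun z => kernelG ν m z z) (discD r) (lam ν) ∧
      ∫ z in discD r, kernelG ν m z z ∂(lam ν) =
        ((ENNReal.ofReal ((2 * (ν - m) - 1) / Real.pi) * lam 0 (discD r)).toReal : ℂ) := by
  set a := 2 * (ν - m) - 1 with ha_def
  have hg : Measurable fun z : Disk => a / Real.pi * (1 - ‖(z : ℂ)‖ ^ 2) ^ (-2 * ν) := by fun_prop
  have hnn : ∀ z : Disk, 0 ≤ a / Real.pi * (1 - ‖(z : ℂ)‖ ^ 2) ^ (-2 * ν) := fun z => by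
    have := one_sub_norm_sq_disk_pos z
    positivity
  have hl : ∫⁻ z in discD r, ENNReal.ofReal (a / Real.pi * (1 - ‖(z : ℂ)‖ ^ 2) ^ (-2 * ν))
      ∂(lam ν) = ENNReal.ofReal (a / Real.pi) * lam 0 (discD r) := by
    rw [setLIntegral_lam_eq ν (measurableSet_discD r) hg.ennreal_ofReal, ← setLIntegral_const]
    refine lintegral_congr fun z => ?_
    have := one_sub_norm_sq_disk_pos z
    rw [← ENNReal.ofReal_mul (by positivity), mul_left_comm, ← Real.rpow_add this]
    simp
  have hi : IntegrableOn (fun z : Disk => a / Real.pi * (1 - ‖(z : ℂ)‖ ^ 2) ^ (-2 * ν))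
      (discD r) (lam ν) := by
    refine ⟨hg.aestronglyMeasurable, ?_⟩
    rw [hasFiniteIntegral_iff_ofReal (.of_forall hnn), hl]
    exact ENNReal.mul_lt_top ENNReal.ofReal_lt_top (lam_zero_discD_lt_top hr0 hr1)
  simp only [kernelG_self, ← ha_def]
  refine ⟨hi.ofReal, ?_⟩
  rw [integral_complex_ofReal, integral_eq_lintegral_of_nonneg_ae (.of_forall hnn)
    hg.aestronglyMeasurable, hl]

/-- This plays the role of the reproducing property on the diagonal. The additive form avoids
subtraction in `ENNReal`. -/
lemma lintegral_inner_add_compl {ν : ℝ} {m : ℕ} (ha : 0 < 2 * (ν - m) - 1) (r : ℝ) :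
    (∫⁻ z in discD r, ∫⁻ w in discD r, ENNReal.ofReal (landauDensity ν m (invCoshSq z w))
      ∂(lam 0) ∂(lam 0)) + crossIntegral ν m r =
      ENNReal.ofReal ((2 * (ν - m) - 1) / Real.pi) * lam 0 (discD r) := by
  have hpair : Measurable fun p : Disk × Disk => ((p.1 : ℂ), (p.2 : ℂ)) := by fun_prop
  rw [crossIntegral, ← lintegral_add_left, ← setLIntegral_const]
  · refine lintegral_congr fun z => ?_
    rw [lintegral_add_compl _ (measurableSet_discD r),
      lintegral_landauDensity_invCoshSq ha (norm_disk_lt_one z)]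
  · exact Measurable.lintegral_prod_right' (f := fun p : Disk × Disk =>
      ENNReal.ofReal (landauDensity ν m (invCoshSq p.1 p.2)))
        ((measurable_landauDensity_invCoshSq ν m).comp hpair)

lemma integrableOn_kernelG_mul_swap {ν : ℝ} {m : ℕ} (ha : 0 < 2 * (ν - m) - 1) {r : ℝ}
    (hr0 : 0 < r) (hr1 : r < 1) :
    IntegrableOn (fun p : Disk × Disk => kernelG ν m p.1 p.2 * kernelG ν m p.2 p.1)
      (discD r ×ˢ discD r) ((lam ν).prod (lam ν)) ∧
    ∫ p in discD r ×ˢ discD r, kernelG ν m p.1 p.2 * kernelG ν m p.2 p.1 ∂((lam ν).prod (lam ν)) =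
      ((∫⁻ z in discD r, ∫⁻ w in discD r, ENNReal.ofReal (landauDensity ν m (invCoshSq z w))
        ∂(lam 0) ∂(lam 0)).toReal : ℂ) := by
  have hk : Measurable fun p : Disk × Disk => kernelNormSq ν m p.1 p.2 :=
    (measurable_kernelNormSq ν m).comp (f := fun p : Disk × Disk => ((p.1 : ℂ), (p.2 : ℂ)))
      (by fun_prop)
  have hnn : ∀ p : Disk × Disk, 0 ≤ kernelNormSq ν m p.1 p.2 := fun p => kernelNormSq_nonneg ν m _ _
  have hl : ∫⁻ p in discD r ×ˢ discD r, ENNReal.ofReal (kernelNormSq ν m p.1 p.2)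
      ∂((lam ν).prod (lam ν)) = ∫⁻ z in discD r, ∫⁻ w in discD r,
        ENNReal.ofReal (landauDensity ν m (invCoshSq z w)) ∂(lam 0) ∂(lam 0) := by
    rw [setLIntegral_prod _ hk.ennreal_ofReal.aemeasurable, setLIntegral_lam_eq ν
      (measurableSet_discD r) (Measurable.lintegral_prod_right' (f := fun p : Disk × Disk =>
        ENNReal.ofReal (kernelNormSq ν m p.1 p.2)) hk.ennreal_ofReal)]
    refine lintegral_congr fun z => ?_
    have hz := one_sub_norm_sq_disk_pos z
    rw [setLIntegral_lam_eq ν (measurableSet_discD r)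
      (g := fun w : Disk => ENNReal.ofReal (kernelNormSq ν m z w))
      (hk.ennreal_ofReal.comp (measurable_prodMk_left : Measurable fun w : Disk => (z, w))),
      ← lintegral_const_mul' _ _ ENNReal.ofReal_ne_top]
    refine lintegral_congr fun w => ?_
    have hw := one_sub_norm_sq_disk_pos w
    rw [← ENNReal.ofReal_mul (by positivity), ← ENNReal.ofReal_mul (by positivity),
      rpow_mul_kernelNormSq]
  have hfin := lintegral_inner_add_compl (ν := ν) (m := m) ha r
  have hi : IntegrableOn (fun p : Disk × Disk => kernelNormSq ν m p.1 p.2) (discD r ×ˢ discD r)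
      ((lam ν).prod (lam ν)) := by
    refine ⟨hk.aestronglyMeasurable, ?_⟩
    rw [hasFiniteIntegral_iff_ofReal (.of_forall hnn), hl]
    refine (le_self_add.trans hfin.le).trans_lt ?_
    exact ENNReal.mul_lt_top ENNReal.ofReal_lt_top (lam_zero_discD_lt_top hr0 hr1)
  simp only [kernelG_mul_kernelG_swap]
  refine ⟨hi.ofReal, ?_⟩
  rw [integral_complex_ofReal, integral_eq_lintegral_of_nonneg_ae (.of_forall hnn)
    hk.aestronglyMeasurable, hl]

lemma variance_numN_eq {ν : ℝ} {m : ℕ} (ha : 0 < 2 * (ν - m) - 1) {P : Measure (Conf Disk)}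
    (hP : IsDeterminantal (kernelG ν m) (lam ν) P) {r : ℝ} (hr0 : 0 < r) (hr1 : r < 1) :
    Var[numN r; P] = (crossIntegral ν m r).toReal := by
  obtain ⟨h1, e1⟩ := integrableOn_kernelG_self (ν := ν) (m := m) ha hr0 hr1
  obtain ⟨h2, e2⟩ := integrableOn_kernelG_mul_swap (ν := ν) (m := m) ha hr0 hr1
  have h := hP.variance_count (measurableSet_discD r) (isCompact_closure_discD hr1) h1 h2
  -- Finiteness of the sum is what allows passing to real numbers and cancelling the interior part.
  have hfin : ENNReal.ofReal ((2 * (ν - m) - 1) / Real.pi) * lam 0 (discD r) ≠ ⊤ :=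
    (ENNReal.mul_lt_top ENNReal.ofReal_lt_top (lam_zero_discD_lt_top hr0 hr1)).ne
  have hsum := lintegral_inner_add_compl (ν := ν) (m := m) ha r
  rw [← hsum] at hfin
  rw [e1, e2, ← hsum, ENNReal.toReal_add (ENNReal.add_ne_top.1 hfin).1
    (ENNReal.add_ne_top.1 hfin).2] at h
  have h' : Var[numN r; P] = Var[fun X => (Conf.count (discD r) X : ℝ); P] := rfl
  rw [h']
  rw [← Complex.ofReal_sub, add_sub_cancel_left, Complex.ofReal_inj] at h
  exact h

lemma mem_exitSet_iff {r : ℝ} (hr0 : 0 < r) (z u : Disk) :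
    (z : ℂ) ∈ exitSet r u ↔ ‖(z : ℂ)‖ < r ∧ r ≤ ‖moebius z u‖ := by
  have hd : 0 < ‖1 + conj (z : ℂ) * u‖ :=
    norm_pos_iff.2 (one_add_conj_mul_ne_zero (norm_disk_lt_one z) (norm_disk_lt_one u))
  have h : r ≤ ‖moebius z u‖ ↔ 1 - ‖moebius z u‖ ^ 2 ≤ 1 - r ^ 2 := by
    rw [sub_le_sub_iff_left, sq_le_sq₀ hr0.le (norm_nonneg _)]
  rw [h, one_sub_norm_moebius_sq (norm_disk_lt_one z) (norm_disk_lt_one u),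
    div_le_iff₀ (by positivity)]
  rfl

lemma measurableSet_exitSet_prod (r : ℝ) :
    MeasurableSet {p : Disk × Disk | (p.1 : ℂ) ∈ exitSet r (p.2 : ℂ)} := by
  refine MeasurableSet.inter (measurableSet_lt (f := fun p : Disk × Disk => ‖(p.1 : ℂ)‖)
    (by fun_prop) measurable_const) ?_
  exact measurableSet_le
    (f := fun p : Disk × Disk => (1 - ‖(p.1 : ℂ)‖ ^ 2) * (1 - ‖(p.2 : ℂ)‖ ^ 2))
    (g := fun p : Disk × Disk => (1 - r ^ 2) * ‖1 + conj (p.1 : ℂ) * (p.2 : ℂ)‖ ^ 2)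
    (by fun_prop) (Continuous.measurable (by fun_prop))

lemma measurable_exitArea (r : ℝ) : Measurable fun u : Disk => exitArea r u :=
  Measurable.lintegral_prod_left' (f := fun p : Disk × Disk =>
    {p : Disk × Disk | (p.1 : ℂ) ∈ exitSet r (p.2 : ℂ)}.indicator (1 : Disk × Disk → ENNReal) p)
    (measurable_one.indicator (measurableSet_exitSet_prod r))

/-- For fixed `z` the change of variable `w = moebius z u` makes the density independent of `z`.
Tonelli then leaves, for each `u`, the area of the `z` in `D_r` with `moebius z u` outside `D_r`. -/
lemma crossIntegral_eq (ν : ℝ) (m : ℕ) {r : ℝ} (hr0 : 0 < r) :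
    crossIntegral ν m r = ∫⁻ u : Disk,
      ENNReal.ofReal (landauDensity ν m (1 - ‖(u : ℂ)‖ ^ 2)) * exitArea r u ∂(lam 0) := by
  let S : Set (Disk × Disk) := {p | (p.1 : ℂ) ∈ exitSet r (p.2 : ℂ)}
  have hS : MeasurableSet S := measurableSet_exitSet_prod r
  have h1 : ∀ z : Disk, (discD r).indicator (fun z : Disk => ∫⁻ w in (discD r)ᶜ,
      ENNReal.ofReal (landauDensity ν m (invCoshSq z w)) ∂(lam 0)) z =
      ∫⁻ u : Disk, ENNReal.ofReal (landauDensity ν m (1 - ‖(u : ℂ)‖ ^ 2)) *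
        S.indicator 1 (z, u) ∂(lam 0) := by
    intro z
    by_cases hz : z ∈ discD r
    · have hB : MeasurableSet {w : ℂ | r ≤ ‖w‖} := measurableSet_le measurable_const measurable_norm
      have e : ∀ w : Disk, (discD r)ᶜ.indicator
          (fun w : Disk => ENNReal.ofReal (landauDensity ν m (invCoshSq z w))) w =
          {w : ℂ | r ≤ ‖w‖}.indicator
            (fun w : ℂ => ENNReal.ofReal (landauDensity ν m (invCoshSq z w))) w := fun w => by
        by_cases hw : r ≤ ‖(w : ℂ)‖
        · rw [Set.indicator_of_mem (s := {w : ℂ | r ≤ ‖w‖}) hw, Set.indicator_of_mem]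
          exact not_lt.2 hw
        · rw [Set.indicator_of_notMem (s := {w : ℂ | r ≤ ‖w‖}) hw, Set.indicator_of_notMem]
          exact fun h => h (not_le.1 hw)
      rw [Set.indicator_of_mem hz, ← lintegral_indicator (measurableSet_discD r).compl,
        lintegral_congr e, ← lintegral_comp_moebius (norm_disk_lt_one z)
          ((measurable_landauDensity_invCoshSq_right ν m z).indicator hB)]
      refine lintegral_congr fun u => ?_
      by_cases hu : r ≤ ‖moebius z u‖
      · rw [Set.indicator_of_mem (s := {w : ℂ | r ≤ ‖w‖}) hu, Set.indicator_of_mem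
          (show (z, u) ∈ S from (mem_exitSet_iff hr0 z u).2 ⟨hz, hu⟩), Pi.one_apply, mul_one,
          invCoshSq_moebius (norm_disk_lt_one z) (norm_disk_lt_one u)]
      · rw [Set.indicator_of_notMem (s := {w : ℂ | r ≤ ‖w‖}) hu, Set.indicator_of_notMem
          (show (z, u) ∉ S from fun h => hu ((mem_exitSet_iff hr0 z u).1 h).2), mul_zero]
    · have e : ∀ u : Disk, S.indicator (1 : Disk × Disk → ENNReal) (z, u) = 0 := fun u =>
        Set.indicator_of_notMem
          (show (z, u) ∉ S from fun h => hz ((mem_exitSet_iff hr0 z u).1 h).1) _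
      simp [Set.indicator_of_notMem hz, e]
  have hF : Measurable fun p : Disk × Disk =>
      ENNReal.ofReal (landauDensity ν m (1 - ‖(p.2 : ℂ)‖ ^ 2)) :=
    (measurable_landauDensity_radial ν m).comp measurable_snd
  have hSm : Measurable (S.indicator (1 : Disk × Disk → ENNReal)) := measurable_one.indicator hS
  rw [crossIntegral, ← lintegral_indicator (measurableSet_discD r), lintegral_congr h1,
    lintegral_lintegral_swap (hF.mul hSm).aemeasurable]
  refine lintegral_congr fun u => ?_
  rw [lintegral_const_mul' _ _ ENNReal.ofReal_ne_top]
  rfl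

/-! ### The constant -/

lemma tanh_hypDist_zero_sq (z : Disk) : Real.tanh (hypDist z 0) ^ 2 = ‖(z : ℂ)‖ ^ 2 := by
  have hA := one_sub_norm_sq_disk_pos z
  have hs := Real.sqrt_pos.2 hA
  have h1 : 1 ≤ 1 / √(1 - ‖(z : ℂ)‖ ^ 2) := by
    rw [le_div_iff₀ hs, one_mul, Real.sqrt_le_one]
    nlinarith [norm_nonneg (z : ℂ)]
  have e : hypDist z 0 = Real.arcosh (1 / √(1 - ‖(z : ℂ)‖ ^ 2)) := by simp [hypDist]
  rw [Real.tanh_eq_sinh_div_cosh, div_pow, Real.sinh_sq, e, Real.cosh_arcosh h1, div_pow,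
    Real.sq_sqrt hA.le]
  field_simp
  ring

lemma constIntegrand_eq (ν : ℝ) (m : ℕ) (z : Disk) : constIntegrand ν m z =
    landauDensity ν m (1 - ‖(z : ℂ)‖ ^ 2) * Real.arccos (1 - 2 * ‖(z : ℂ)‖ ^ 2) := by
  rw [constIntegrand, fFun, tanh_hypDist_zero_sq, landauDensity]
  congr 4
  ring

lemma constIntegrand_nonneg (ν : ℝ) (m : ℕ) (z : Disk) : 0 ≤ constIntegrand ν m z := by
  rw [constIntegrand_eq]
  exact mul_nonneg (landauDensity_nonneg _ _ _) (Real.arccos_nonneg _)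

lemma measurable_constIntegrand (ν : ℝ) (m : ℕ) : Measurable (constIntegrand ν m) := by
  have hm := measurable_landauDensity ν m
  have hc := Real.continuous_arccos.measurable
  simp only [funext (constIntegrand_eq ν m)]
  fun_prop

lemma integrable_constIntegrand {ν : ℝ} {m : ℕ} (ha : 0 < 2 * (ν - m) - 1) :
    Integrable (constIntegrand ν m) (lam 0) := by
  have hm := measurable_landauDensity ν m
  refine ⟨(measurable_constIntegrand ν m).aestronglyMeasurable, ?_⟩
  rw [hasFiniteIntegral_iff_ofReal (.of_forall (constIntegrand_nonneg ν m))]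
  calc _ ≤ ∫⁻ z : Disk, ENNReal.ofReal Real.pi *
        ENNReal.ofReal (landauDensity ν m (1 - ‖(z : ℂ)‖ ^ 2)) ∂(lam 0) := by
        refine lintegral_mono fun z => ?_
        rw [constIntegrand_eq, mul_comm, ENNReal.ofReal_mul (Real.arccos_nonneg _)]
        gcongr
        exact Real.arccos_le_pi _
    _ < ⊤ := by
        rw [lintegral_const_mul' _ _ ENNReal.ofReal_ne_top, lintegral_landauDensity_radial ha]
        exact ENNReal.mul_lt_top ENNReal.ofReal_lt_top ENNReal.ofReal_lt_top

lemma lintegral_constIntegrand {ν : ℝ} {m : ℕ} (ha : 0 < 2 * (ν - m) - 1) :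
    ∫⁻ z : Disk, ENNReal.ofReal (landauDensity ν m (1 - ‖(z : ℂ)‖ ^ 2)) *
      ENNReal.ofReal (Real.arccos (1 - 2 * ‖(z : ℂ)‖ ^ 2)) ∂(lam 0) =
      ENNReal.ofReal (constC ν m) := by
  rw [constC, ofReal_integral_eq_lintegral_ofReal (integrable_constIntegrand ha)
    (.of_forall (constIntegrand_nonneg ν m))]
  refine lintegral_congr fun z => ?_
  rw [constIntegrand_eq, ENNReal.ofReal_mul (landauDensity_nonneg _ _ _)]

lemma ae_lam_zero_ne_zero : ∀ᵐ z : Disk ∂(lam 0), (z : ℂ) ≠ 0 := by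
  have h : ∀ᵐ z : Disk ∂(Measure.comap ((↑) : Disk → ℂ) volume), (z : ℂ) ≠ 0 := by
    rw [ae_iff, (MeasurableEmbedding.subtype_coe Metric.isOpen_ball.measurableSet).comap_apply]
    refine measure_mono_null (t := {(0 : ℂ)}) ?_ (measure_singleton _)
    rintro _ ⟨z, hz, rfl⟩
    simpa using hz
  exact (withDensity_absolutelyContinuous _ _).ae_le h

/-- Since `arccos(1 - 2|z|²) > 0` off the origin, a zero constant would force the density to vanish
almost everywhere, against its total mass `a / π > 0`. -/
lemma constC_pos {ν : ℝ} {m : ℕ} (ha : 0 < 2 * (ν - m) - 1) : 0 < constC ν m := by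
  have hm := measurable_landauDensity ν m
  refine lt_of_le_of_ne (integral_nonneg (constIntegrand_nonneg ν m)) fun h0 => ?_
  have h := (integral_eq_zero_iff_of_nonneg (constIntegrand_nonneg ν m)
    (integrable_constIntegrand ha)).1 h0.symm
  have h1 : ∫⁻ z : Disk, ENNReal.ofReal (landauDensity ν m (1 - ‖(z : ℂ)‖ ^ 2)) ∂(lam 0) = 0 := by
    rw [lintegral_eq_zero_iff (by fun_prop)]
    filter_upwards [h, ae_lam_zero_ne_zero] with z hz hz0
    rw [constIntegrand_eq] at hz
    have hacos : 0 < Real.arccos (1 - 2 * ‖(z : ℂ)‖ ^ 2) := by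
      rw [Real.arccos_pos]
      have := norm_pos_iff.2 hz0
      nlinarith
    rw [(mul_eq_zero.1 hz).resolve_right hacos.ne']
    simp
  rw [lintegral_landauDensity_radial ha, ENNReal.ofReal_eq_zero] at h1
  have := div_pos ha Real.pi_pos
  linarith

/-! ### Asymptotics of the variance -/

lemma tendsto_one_sub_sq_mul_crossIntegral {ν : ℝ} {m : ℕ} (ha : 0 < 2 * (ν - m) - 1) :
    Tendsto (fun r : ℝ => ENNReal.ofReal (1 - r ^ 2) * crossIntegral ν m r) (𝓝[<] 1)
      (𝓝 (ENNReal.ofReal (constC ν m))) := by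
  have hm := measurable_landauDensity ν m
  have hr : ∀ᶠ r : ℝ in 𝓝[<] 1, r ∈ Set.Ioo (0 : ℝ) 1 := Ioo_mem_nhdsLT zero_lt_one
  have key : Tendsto (fun r : ℝ => ∫⁻ u : Disk,
      ENNReal.ofReal (landauDensity ν m (1 - ‖(u : ℂ)‖ ^ 2)) *
        (ENNReal.ofReal (1 - r ^ 2) * exitArea r u) ∂(lam 0)) (𝓝[<] 1)
      (𝓝 (ENNReal.ofReal (constC ν m))) := by
    rw [← lintegral_constIntegrand ha]
    refine tendsto_lintegral_filter_of_dominated_convergence (fun u : Disk =>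
      ENNReal.ofReal (landauDensity ν m (1 - ‖(u : ℂ)‖ ^ 2)) * ENNReal.ofReal (2 * Real.pi))
      (.of_forall fun r => ?_) ?_ ?_ ?_
    · have := measurable_exitArea r
      fun_prop
    · filter_upwards [hr] with r hr
      refine .of_forall fun u => ?_
      gcongr
      exact ofReal_mul_exitArea_le hr.1 hr.2 u
    · rw [lintegral_mul_const' _ _ ENNReal.ofReal_ne_top, lintegral_landauDensity_radial ha]
      exact ENNReal.mul_ne_top ENNReal.ofReal_ne_top ENNReal.ofReal_ne_top
    · refine .of_forall fun u => ?_
      exact ENNReal.Tendsto.const_mul (tendsto_ofReal_mul_exitArea (norm_disk_lt_one u))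
        (Or.inr ENNReal.ofReal_ne_top)
  refine key.congr' ?_
  filter_upwards [hr] with r hr
  rw [crossIntegral_eq ν m hr.1, ← lintegral_const_mul' _ _ ENNReal.ofReal_ne_top]
  refine lintegral_congr fun u => ?_
  ring

lemma isEquivalent_variance_numN {ν : ℝ} {m : ℕ} (ha : 0 < 2 * (ν - m) - 1)
    {P : Measure (Conf Disk)} (hP : IsDeterminantal (kernelG ν m) (lam ν) P) :
    (fun r : ℝ => Var[numN r; P]) ~[𝓝[<] 1] (fun r : ℝ => constC ν m / (1 - r ^ 2)) := by
  have hr : ∀ᶠ r : ℝ in 𝓝[<] 1, r ∈ Set.Ioo (0 : ℝ) 1 := Ioo_mem_nhdsLT zero_lt_one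
  have hC := constC_pos (ν := ν) (m := m) ha
  have h := (ENNReal.tendsto_toReal ENNReal.ofReal_ne_top).comp
    (tendsto_one_sub_sq_mul_crossIntegral (ν := ν) (m := m) ha)
  rw [ENNReal.toReal_ofReal hC.le] at h
  refine isEquivalent_of_tendsto_one ?_
  have h2 := h.div_const (constC ν m)
  rw [div_self hC.ne'] at h2
  refine h2.congr' ?_
  filter_upwards [hr] with r hr
  have hpos : 0 < 1 - r ^ 2 := by nlinarith [hr.1, hr.2]
  simp only [Function.comp_apply, Pi.div_apply, ENNReal.toReal_mul,
    ENNReal.toReal_ofReal hpos.le, variance_numN_eq ha hP hr.1 hr.2]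
  field_simp

end

theorem theorem1 (ν : ℝ) (hν : 1 / 2 < ν) (m : ℕ) (hm : m ≤ ⌊ν - 1 / 2⌋₊)
    (hνm : 2 * (ν - m) - 1 ≠ 0)
    (P : Measure (Conf Disk)) (hP : IsDeterminantal (kernelG ν m) (lam ν) P) :
    (∀ r : ℝ, 0 < r → r < 1 → MemLp (numN r) 2 P) ∧
    Integrable (constIntegrand ν m) (lam 0) ∧
    (fun r : ℝ => Var[numN r; P]) ~[𝓝[<] 1] (fun r : ℝ => constC ν m / (1 - r ^ 2)) := by
  have h1 : (m : ℝ) ≤ ν - 1 / 2 := (Nat.le_floor_iff (by linarith)).1 hm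
  -- The floor bound only gives `≥ 0`; the excluded value makes it strict.
  have ha : 0 < 2 * (ν - m) - 1 := lt_of_le_of_ne (by linarith) hνm.symm
  exact ⟨fun r _ hr1 => hP.memLp_count (measurableSet_discD r) (isCompact_closure_discD hr1),
    integrable_constIntegrand ha, isEquivalent_variance_numN ha hP⟩
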